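/- Let $A:\mathbb R^n\to\mathbb R^n$ and $B:\mathbb R^m\to\mathbb R^m$ be linear, let $\sigma\in\mathbb R$ and $0<\epsilon\le1$, and let $f:\mathbb R^n\times\mathbb R^m\to\mathbb R^n$, $g:\mathbb R^n\times\mathbb R^m\to\mathbb R^m$ be Lipschitz with constants $L_f,L_g\ge 0$ for the norm $|(x,y)|=|x|+|y|$ on $\mathbb R^{n+m}$ (Euclidean norms on $\mathbb R^n$ and $\mathbb R^m$). Let $\Omega=\{\omega\in C(\mathbb R,\mathbb R^m):\omega(0)=0\}$ with the law $\mathbb P$ of a standard two-sided $\mathbb R^m$-valued Wiener process $W(t)=\omega(t)$, and let $\theta_t\omega=\omega(\cdot+t)-\omega(t)$. Let $\eta^\epsilon(\theta_t\omega)$ be the stationary solution of $d\eta=\frac1\epsilon B\eta\,dt+\frac{\sigma}{\sqrt\epsilon}\,dW$, that is, $$\eta^\epsilon(\omega)=\frac{\sigma}{\sqrt\epsilon}\int_{-\infty}^0e^{-sB/\epsilon}\,d\omega(s)=\frac{\sigma}{\sqrt\epsilon}\,\frac1\epsilon\int_{-\infty}^0Be^{-sB/\epsilon}\omega(s)\,ds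 .$$ Put $F(x,y,\omega)=f(x,y+\eta^\epsilon(\omega))$, $G(x,y,\omega)=g(x,y+\eta^\epsilon(\omega))$, and consider the random system $$\dot X=AX+F(X,Y,\theta_t\omega),\qquad \dot Y=\tfrac1\epsilon BY+\tfrac1\epsilon G(X,Y,\theta_t\omega),\qquad t\ge0. \tag{1}$$ Assume: (H1) there are $\alpha\ge0>\beta$ with $|e^{tA}x|\le e^{\alpha t}|x|$ for $t\le0$, $x\in\mathbb R^n$, and $|e^{tB}y|\le e^{\beta t}|y|$ for $t\ge0$, $y\in\mathbb R^m$; (H2) for every $\epsilon'\in(0,1]$ there is $\lambda$ with $\beta<\epsilon'\lambda<\alpha$ and $\frac{L_f}{\alpha-\lambda}+\frac{L_g}{\epsilon'\lambda-\beta}<1$; (gap) there is $\delta>0$ with $\epsilon\alpha+\epsilon L_f+\epsilon\delta L_f+\beta+L_g+\delta^{-1}L_g<0$. Then $\gamma:=-\beta-L_g-\delta^{-1}L_g>0$, $\eta^\epsilon$ is measurable and $t\mapsto\eta^\epsilon(\theta_t\omega)$ almost surely is continuous and solves its equation on $\mathbb R$, and for almost every $\omega$ the system (1) has for each initial value $z$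 a unique solution $\Phi^\epsilon(t,\omega)z$ on $[0,\infty)$. There is $\lambda<0$ for which the inequalities in (H2) hold with $\epsilon'=\epsilon$, and for every such $\lambda<0$ the following holds. (a) Let $C^-_\lambda$ be the space of continuous $u:(-\infty,0]\to\mathbb R^{n+m}$ with $\sup_{t\le0}e^{-\lambda t}|u(t)|<\infty$. For almost every $\omega$ and all $X_0\in\mathbb R^n$ there is a unique $(X^*,Y^*)\in C^-_\lambda$ such that for $t\le 0$ $$X^*(t)=e^{tA}X_0+\int_0^te^{(t-s)A}F(X^*(s),Y^*(s),\theta_s\omega)\,ds,\qquad Y^*(t)=\frac1\epsilon\int_{-\infty}^te^{(t-s)B/\epsilon}G(X^*(s),Y^*(s),\theta_s\omega)\,ds .$$ Put $h^\epsilon(X_0,\omega)=Y^*(0)=\frac1\epsilon\int_{-\infty}^0e^{-sB/\epsilon}G(X^*(s),Y^*(s),\theta_s\omega)\,ds$ and $\mathcal M^\epsilon(\omega)=\{(X,h^\epsilon(X,\omega)):X\in\mathbb R^n\}$. (b) $\mathcal M^\epsilon$ is a Lipschitz random invariant manifold of $\Phi^\epsilon$: almost surely $\mathcal M^\epsilon(\omega)$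 is non-empty and closed, is the graph of a Lipschitz map (with a deterministic Lipschitz constant) depending measurably on $\omega$, and $\Phi^\epsilon(t,\omega)\mathcal M^\epsilon(\omega)\subset\mathcal M^\epsilon(\theta_t\omega)$ for all $t\ge0$; moreover $\omega\mapsto\inf_{z'\in\mathcal M^\epsilon(\omega)}|z-z'|$ is a random variable for each $z$ (measurability being understood up to $\mathbb P$-null sets). It is almost surely asymptotically complete: there are $k>0$ and a positive random variable $D(\omega)$ such that for almost every $\omega$ and every $z\in\mathbb R^{n+m}$ there is $z'\in\mathcal M^\epsilon(\omega)$ with $|\Phi^\epsilon(t,\omega)z-\Phi^\epsilon(t,\omega)z'|\le D(\omega)|z-z'|e^{-kt}$ for all $t\ge0$. (c) There is a deterministic constant $D>0$ such that for almost every $\omega$ and every solution $(X,Y)$ of (1) there is a solution $(\tilde X,\tilde Y)$ of (1) with $(\tilde X(t),\tilde Y(t))\in\mathcal M^\epsilon(\theta_t\omega)$ for all $t\ge0$, governed by the $n$-dimensional equation $$\dot{\tilde X}=A\tilde X+F(\tilde X,h^\epsilon(\tilde X,\theta_t\omega),\theta_t\omega),\qquad \tilde Y=h^\epsilon(\tilde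 X,\theta_t\omega),$$ such that for all $t\ge0$ $$|(X(t),Y(t))-(\tilde X(t),\tilde Y(t))|\le D\,|(X(0),Y(0))-(\tilde X(0),\tilde Y(0))|\,e^{-\gamma t/\epsilon}.$$ -/

import Mathlib

open MeasureTheory ProbabilityTheory Set

noncomputable section

/-- `ℝⁿ` with its Euclidean norm. -/
abbrev Eucl (n : ℕ) : Type := EuclideanSpace ℝ (Fin n)

/-! ### The canonical two-sided Wiener space and its shift -/

/-- Continuous paths `ω : ℝ → ℝᵐ` with `ω(0) = 0`. -/
def WienerPath (m : ℕ) : Type := {w : ℝ → Eucl m // Continuous w ∧ w 0 = 0}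

namespace WienerPath

instance instCoeFun (m : ℕ) : CoeFun (WienerPath m) (fun _ => ℝ → Eucl m) := ⟨fun w => w.1⟩

/-- The `σ`-algebra generated by the evaluations, which is the Borel `σ`-algebra of the topology of
locally uniform convergence. -/
instance instMeasurableSpace (m : ℕ) : MeasurableSpace (WienerPath m) :=
  MeasurableSpace.comap (fun w => w.1) inferInstance

/-- The Wiener shift `θ_t ω = ω(· + t) - ω(t)`. -/
def shift {m : ℕ} (t : ℝ) (w : WienerPath m) : WienerPath m :=
  ⟨fun s => w (s + t) - w t,
    (w.2.1.comp (continuous_id.add continuous_const)).sub continuous_const, by simp⟩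

end WienerPath

/-- `P` is the law of a standard two-sided `ℝᵐ`-valued Wiener process: under `P` the coordinate
process has independent increments, and `ω(t) - ω(s)` is Gaussian with mean `0` and covariance
`(t - s) I`. -/
structure IsWienerMeasure {m : ℕ} (P : Measure (WienerPath m)) : Prop where
  isProbabilityMeasure : IsProbabilityMeasure P
  map_increment : ∀ s t : ℝ, s ≤ t →
    P.map (fun w => w t - w s) = (stdGaussian (Eucl m)).map (fun x => Real.sqrt (t - s) • x)
  hasIndepIncrements : HasIndepIncrements (fun (t : ℝ) (w : WienerPath m) => w t) P

/-! ### The phase space -/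

/-- The norm `|x| + |y|` on `ℝⁿ × ℝᵐ`. -/
def sumNorm {n m : ℕ} (z : Eucl n × Eucl m) : ℝ := ‖z.1‖ + ‖z.2‖

/-! ### Random invariant manifolds, asymptotic completeness -/

/-- `M` is a random set: almost surely non-empty and closed, with random distance functions. -/
structure IsRandomSet {n m : ℕ} (P : Measure (WienerPath m))
    (M : WienerPath m → Set (Eucl n × Eucl m)) : Prop where
  nonempty_closed : ∀ᵐ ω ∂P, (M ω).Nonempty ∧ IsClosed (M ω)
  dist_measurable : ∀ z : Eucl n × Eucl m,
    AEMeasurable (fun ω => ⨅ z' : ↥(M ω), sumNorm (z - (z' : Eucl n × Eucl m))) P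

/-- `M` is a Lipschitz invariant manifold of `Φ` over the Wiener shift: a positively invariant
random set which is the graph of a random Lipschitz map `ℝⁿ → ℝᵐ`. -/
structure IsLipschitzInvariantManifold {n m : ℕ} (P : Measure (WienerPath m))
    (Φ : ℝ → WienerPath m → Eucl n × Eucl m → Eucl n × Eucl m)
    (M : WienerPath m → Set (Eucl n × Eucl m)) : Prop where
  isRandomSet : IsRandomSet P M
  invariant : ∀ᵐ ω ∂P, ∀ t : ℝ, 0 ≤ t → ∀ z ∈ M ω, Φ t ω z ∈ M (WienerPath.shift t ω)
  lipschitz_graph : ∃ (ψ : Eucl n → WienerPath m → Eucl m) (K : NNReal),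
    (∀ x, AEMeasurable (ψ x) P) ∧
    ∀ᵐ ω ∂P, LipschitzWith K (fun x => ψ x ω) ∧ M ω = range (fun x => (x, ψ x ω))

/-- Almost sure asymptotic completeness of an invariant manifold `M` of `Φ`. -/
structure IsAsymptoticallyComplete {n m : ℕ} (P : Measure (WienerPath m))
    (Φ : ℝ → WienerPath m → Eucl n × Eucl m → Eucl n × Eucl m)
    (M : WienerPath m → Set (Eucl n × Eucl m)) : Prop where
  isManifold : IsLipschitzInvariantManifold P Φ M
  attraction : ∃ k : ℝ, 0 < k ∧ ∃ D : WienerPath m → ℝ, Measurable D ∧ (∀ ω, 0 < D ω) ∧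
    ∀ᵐ ω ∂P, ∀ z : Eucl n × Eucl m, ∃ z' ∈ M ω, ∀ t : ℝ, 0 ≤ t →
      sumNorm (Φ t ω z - Φ t ω z') ≤ D ω * sumNorm (z - z') * Real.exp (-(k * t))

/-! ### The slow-fast system -/

/-- The data of the system `ẋ = A x + f(x, y)`, `ẏ = ε⁻¹ B y + ε⁻¹ g(x, y) + σ ε^{-1/2} Ẇ`
on `ℝⁿ × ℝᵐ`. -/
structure SlowFastSystem (n m : ℕ) where
  A : Eucl n →L[ℝ] Eucl n
  B : Eucl m →L[ℝ] Eucl m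
  f : Eucl n → Eucl m → Eucl n
  g : Eucl n → Eucl m → Eucl m
  σ : ℝ
  ε : ℝ

namespace SlowFastSystem

variable {n m : ℕ} (S : SlowFastSystem n m)

/-- `η^ε(ω) = σ ε^{-1/2} ∫_{-∞}^0 e^{-sB/ε} dω(s)`, the stochastic integral being written pathwise
by integration by parts as `ε⁻¹ ∫_{-∞}^0 B e^{-sB/ε} ω(s) ds`. The process `t ↦ η^ε(θ_t ω)` is the
stationary Ornstein-Uhlenbeck process. -/
def ou (ω : WienerPath m) : Eucl m :=
  (S.σ / Real.sqrt S.ε) • (S.ε⁻¹ •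
    ∫ s in Iic (0 : ℝ), S.B (NormedSpace.exp ((-s / S.ε) • S.B) (ω s)))

/-- `η` is measurable, and `t ↦ η(θ_t ω)` solves `dη = ε⁻¹ B η dt + σ ε^{-1/2} dW` on `ℝ`. The noise
is additive, so the equation is meaningful pathwise. -/
def SolvesOU (P : Measure (WienerPath m)) (η : WienerPath m → Eucl m) : Prop :=
  Measurable η ∧ ∀ᵐ ω ∂P,
    Continuous (fun t : ℝ => η (WienerPath.shift t ω)) ∧
    ∀ t : ℝ, η (WienerPath.shift t ω) =
      η ω + (∫ s in (0 : ℝ)..t, S.ε⁻¹ • S.B (η (WienerPath.shift s ω)))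
        + (S.σ / Real.sqrt S.ε) • ω t

/-- `F(x, y, ω) = f(x, y + η^ε(ω))`. -/
def F (x : Eucl n) (y : Eucl m) (ω : WienerPath m) : Eucl n := S.f x (y + S.ou ω)

/-- `G(x, y, ω) = g(x, y + η^ε(ω))`. -/
def G (x : Eucl n) (y : Eucl m) (ω : WienerPath m) : Eucl m := S.g x (y + S.ou ω)

/-- `Z = (X, Y)` solves on `[0, ∞)` the random system `Ẋ = A X + F(X, Y, θ_t ω)`,
`Ẏ = ε⁻¹ B Y + ε⁻¹ G(X, Y, θ_t ω)`. -/
def IsSolution (ω : WienerPath m) (Z : ℝ → Eucl n × Eucl m) : Prop :=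
  ∀ t : ℝ, 0 ≤ t →
    HasDerivWithinAt (fun r => (Z r).1)
      (S.A (Z t).1 + S.F (Z t).1 (Z t).2 (WienerPath.shift t ω)) (Ici 0) t ∧
    HasDerivWithinAt (fun r => (Z r).2)
      (S.ε⁻¹ • S.B (Z t).2 + S.ε⁻¹ • S.G (Z t).1 (Z t).2 (WienerPath.shift t ω)) (Ici 0) t

open Classical in
/-- The solution map `Φ^ε(t, ω) z`, for `t ≥ 0`, of the random system. -/
def flow (t : ℝ) (ω : WienerPath m) (z : Eucl n × Eucl m) : Eucl n × Eucl m :=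
  if h : ∃ Z, S.IsSolution ω Z ∧ Z 0 = z then h.choose t else z

/-! ### The Lyapunov-Perron manifold -/

/-- The inequality `L_f / (α - λ) + L_g / (ε λ - β) < 1` with `β < ε λ < α`. -/
def SpectralGap (α β Lf Lg ε lam : ℝ) : Prop :=
  β < ε * lam ∧ ε * lam < α ∧ Lf / (α - lam) + Lg / (ε * lam - β) < 1

/-- The restriction of `u` to `(-∞, 0]` belongs to the space `C_λ⁻`. -/
def MemCMinus (lam : ℝ) (u : ℝ → Eucl n × Eucl m) : Prop :=
  ContinuousOn u (Iic 0) ∧ ∃ C : ℝ, ∀ t : ℝ, t ≤ 0 → Real.exp (-(lam * t)) * sumNorm (u t) ≤ C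

/-- The Lyapunov-Perron map `T(X₀, ω, u)(t)`. -/
def perronMap (X0 : Eucl n) (ω : WienerPath m) (u : ℝ → Eucl n × Eucl m) (t : ℝ) :
    Eucl n × Eucl m :=
  (NormedSpace.exp (t • S.A) X0 +
      ∫ s in (0 : ℝ)..t,
        NormedSpace.exp ((t - s) • S.A) (S.F (u s).1 (u s).2 (WienerPath.shift s ω)),
    S.ε⁻¹ • ∫ s in Iic t,
      NormedSpace.exp (((t - s) / S.ε) • S.B) (S.G (u s).1 (u s).2 (WienerPath.shift s ω)))

/-- `u` is a fixed point of the Lyapunov-Perron map in `C_λ⁻`. -/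
def IsPerronFixedPoint (lam : ℝ) (X0 : Eucl n) (ω : WienerPath m)
    (u : ℝ → Eucl n × Eucl m) : Prop :=
  MemCMinus lam u ∧ ∀ t : ℝ, t ≤ 0 → u t = S.perronMap X0 ω u t

open Classical in
/-- The fixed point `(X*, Y*)` of the Lyapunov-Perron map in `C_λ⁻`. -/
def perronOrbit (lam : ℝ) (X0 : Eucl n) (ω : WienerPath m) : ℝ → Eucl n × Eucl m :=
  if h : ∃ u, S.IsPerronFixedPoint lam X0 ω u then h.choose else 0

/-- `h^ε(X₀, ω) = ε⁻¹ ∫_{-∞}^0 e^{-sB/ε} G(X*(s), Y*(s), θ_s ω) ds`. -/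
def slowMap (lam : ℝ) (X0 : Eucl n) (ω : WienerPath m) : Eucl m :=
  S.ε⁻¹ • ∫ s in Iic (0 : ℝ), NormedSpace.exp ((-s / S.ε) • S.B)
    (S.G (S.perronOrbit lam X0 ω s).1 (S.perronOrbit lam X0 ω s).2 (WienerPath.shift s ω))

/-- The random manifold `M^ε(ω) = {(X, h^ε(X, ω)) : X ∈ ℝⁿ}`. -/
def slowManifold (lam : ℝ) (ω : WienerPath m) : Set (Eucl n × Eucl m) :=
  range (fun X => (X, S.slowMap lam X ω))

/-- `X` solves on `[0, ∞)` the reduced equation `Ẋ = A X + F(X, h^ε(X, θ_t ω), θ_t ω)`. -/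
def IsReducedSolution (lam : ℝ) (ω : WienerPath m) (X : ℝ → Eucl n) : Prop :=
  ∀ t : ℝ, 0 ≤ t →
    HasDerivWithinAt X (S.A (X t) +
      S.F (X t) (S.slowMap lam (X t) (WienerPath.shift t ω)) (WienerPath.shift t ω)) (Ici 0) t

end SlowFastSystem

end

/-!
The proof is pathwise. Almost every noise path `ω` satisfies `∫_{-∞}^0 e^{cs} |ω(s)| ds < ∞` for
every `c > 0` (`SubexpGrowth`): this follows from `𝔼 |ω(s)| = O(√|s|)` and Tonelli's theorem
(`IsWienerMeasure.ae_subexpGrowth`), and the set of such paths is invariant under the shift. On this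
set `t ↦ η(θ_t ω)` is `σ ε^{-1/2} (J(t) + ω(t))`, where `J` is an exponential convolution of `ω`
(`SlowFastSystem.ou_shift_eq`). It is continuous, of the same mean growth as `ω`, and solves the
Ornstein-Uhlenbeck equation. From here on the path is fixed, and the random system is a deterministic
nonautonomous `SplitSystem` whose time translations correspond to the shifts of `ω`.

The Lyapunov-Perron map of a split system is a contraction in a weighted sup-norm
(`SplitSystem.exists_isPerronOrbit`); it maps the space `C_λ⁻` to itself because the forcing is
integrable against `e^{-λs}`. By the variation of constants formula, its fixed points are the
solutions on `(-∞, 0]` of growth at most `e^{λt}` (`SplitSystem.isPerronOrbit_iff`). In this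
description it is clear that the manifold is positively invariant, that each of its points at a later
time is reached along the manifold, and that it does not depend on `λ`. Measurability of the graph
map holds because the fixed point is a limit of Picard iterates, which are jointly measurable in time
and path; the distance functions are infima over a countable dense set.

For a difference `(x, y)` of two solutions, the indefinite form `|y|² - δ² |x|²` satisfies a linear
differential inequality, whatever its sign (`SplitSystem.cone_form_le`). Hence a difference which is
outside the cone `|y| ≤ δ |x|` at some time was outside it before, and outside the cone `|y|` decays
like `e^{-γt/ε}`. Backwards in time this growth is incompatible with the growth in `C_λ⁻` for a
suitable `λ`, so that the manifold is a Lipschitz graph, with a constant `δ'` slightly smaller than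
`δ`. Finally let `Z` be a solution, and for each `k` let `Zₖ` be the solution on the manifold with the
same slow component as `Z` at time `k`. The difference `Z - Zₖ` is outside the cone of aperture `δ` on
`[0, k]`; as `δ' < δ`, this bounds the initial values `Zₖ(0)`, and a limit of them is the initial
value of the tracking solution (`SplitSystem.exists_tracking_solution`). Its estimate holds with the
constant `D = 1 + δ⁻¹`.
-/

/-! ### Contractions in weighted sup-norms -/

section WeightedContraction

open Filter Topology

variable {E : Type*} [NormedAddCommGroup E]

/-- `u` is continuous on `I` and differs from `u₀` there by at most a multiple of the weight `W`,
the distance being measured by `N`. -/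
def InWeightedClass (I : Set ℝ) (W : ℝ → ℝ) (N : E → ℝ) (u₀ u : ℝ → E) : Prop :=
  ContinuousOn u I ∧ ∃ C, ∀ t ∈ I, N (u t - u₀ t) ≤ C * W t

/-- Banach's fixed point theorem in a weighted sup-norm. The norm inside the supremum is an
arbitrary `N` equivalent to the norm of `E`, because the contraction constant depends on it. The
fixed point is moreover the pointwise limit of the Picard iterates. -/
theorem exists_fixedPoint_of_weighted_contraction [CompleteSpace E] {I : Set ℝ} {W : ℝ → ℝ}
    (hW : ContinuousOn W I) (hW0 : ∀ t ∈ I, 0 ≤ W t) {N : E → ℝ} {c : ℝ}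
    (hN1 : ∀ z, ‖z‖ ≤ N z) (hN2 : ∀ z, N z ≤ c * ‖z‖) {q : ℝ} (hq0 : 0 ≤ q) (hq1 : q < 1)
    (T : (ℝ → E) → ℝ → E) (u₀ : ℝ → E) (hu₀ : ContinuousOn u₀ I)
    (hT : ∀ u, InWeightedClass I W N u₀ u → ContinuousOn (T u) I)
    (h0 : ∃ C, ∀ t ∈ I, N (T u₀ t - u₀ t) ≤ C * W t)
    (hc : ∀ u v, InWeightedClass I W N u₀ u → InWeightedClass I W N u₀ v → ∀ C,
      (∀ t ∈ I, N (u t - v t) ≤ C * W t) → ∀ t ∈ I, N (T u t - T v t) ≤ q * C * W t) :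
    ∃ u, InWeightedClass I W N u₀ u ∧ (∀ t ∈ I, u t = T u t) ∧
      ∀ t ∈ I, Tendsto (fun k => (T^[k] u₀) t) atTop (𝓝 (u t)) := by
  obtain ⟨C₀, hC₀⟩ := h0
  set C := max C₀ 0 with hC
  have hC0 : 0 ≤ C := le_max_right _ _
  have h0' : ∀ t ∈ I, N (T u₀ t - u₀ t) ≤ C * W t := fun t ht =>
    (hC₀ t ht).trans (mul_le_mul_of_nonneg_right (le_max_left _ _) (hW0 t ht))
  set x : ℕ → ℝ → E := fun k => T^[k] u₀ with hx
  have hxs : ∀ k, x (k + 1) = T (x k) := fun k => Function.iterate_succ_apply' T k u₀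
  have hx0 : x 0 = u₀ := rfl
  have h1q : 0 < 1 - q := by linarith
  -- a bound on the norm of a difference propagates to `N`
  have hNbound : ∀ (z : E) (b : ℝ), ‖z‖ ≤ b → N z ≤ |c| * b := fun z b hb =>
    (hN2 z).trans ((mul_le_mul_of_nonneg_right (le_abs_self c) (norm_nonneg z)).trans
      (mul_le_mul_of_nonneg_left hb (abs_nonneg c)))
  -- `x 0, …, x k` are in the class, with geometrically small consecutive differences
  have key : ∀ k, (∀ j ≤ k, InWeightedClass I W N u₀ (x j)) ∧
      ∀ j ≤ k, ∀ t ∈ I, N (x (j + 1) t - x j t) ≤ q ^ j * C * W t := by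
    intro k
    induction k with
    | zero =>
      refine ⟨fun j hj => ?_, fun j hj t ht => ?_⟩
      · obtain rfl : j = 0 := by omega
        refine ⟨hu₀, 0, fun t ht => ?_⟩
        simpa [hx0] using hN2 0
      · obtain rfl : j = 0 := by omega
        simpa [hxs, hx0] using h0' t ht
    | succ k ih =>
      have hdist : ∀ t ∈ I, ‖x (k + 1) t - u₀ t‖ ≤ C * W t / (1 - q) := by
        intro t ht
        have hsum : x (k + 1) t - u₀ t = ∑ j ∈ Finset.range (k + 1), (x (j + 1) t - x j t) := by
          rw [Finset.sum_range_sub (fun j => x j t), hx0]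
        rw [hsum]
        calc _ ≤ ∑ j ∈ Finset.range (k + 1), q ^ j * (C * W t) := by
              refine (norm_sum_le _ _).trans (Finset.sum_le_sum fun j hj => ?_)
              have := ih.2 j (by simpa using Finset.mem_range_succ_iff.1 hj) t ht
              rw [mul_assoc] at this
              exact (hN1 _).trans this
          _ = (∑ j ∈ Finset.range (k + 1), q ^ j) * (C * W t) := by rw [Finset.sum_mul]
          _ ≤ (1 - q)⁻¹ * (C * W t) := by
              refine mul_le_mul_of_nonneg_right ?_ (mul_nonneg hC0 (hW0 t ht))
              rw [← tsum_geometric_of_lt_one hq0 hq1]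
              exact (summable_geometric_of_lt_one hq0 hq1).sum_le_tsum _ fun j _ => by positivity
          _ = _ := by field_simp
      have hcls : InWeightedClass I W N u₀ (x (k + 1)) := by
        refine ⟨by rw [hxs]; exact hT _ (ih.1 k le_rfl), |c| * (C / (1 - q)), fun t ht => ?_⟩
        refine (hNbound _ _ (hdist t ht)).trans_eq ?_
        field_simp
      refine ⟨fun j hj => ?_, fun j hj t ht => ?_⟩
      · rcases Nat.le_succ_iff.1 hj with h | h
        · exact ih.1 j h
        · rwa [h]
      · rcases Nat.le_succ_iff.1 hj with h | h
        · exact ih.2 j h t ht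
        · subst h
          have := hc _ _ hcls (ih.1 k le_rfl) (q ^ k * C) (ih.2 k le_rfl) t ht
          rw [hxs (k + 1), hxs k, pow_succ]
          rw [hxs k] at this
          linarith
  have hcls : ∀ k, InWeightedClass I W N u₀ (x k) := fun k => (key k).1 k le_rfl
  have hdiff : ∀ t ∈ I, ∀ k, dist (x k t) (x (k + 1) t) ≤ C * W t * q ^ k := by
    intro t ht k
    rw [dist_comm, dist_eq_norm]
    refine (hN1 _).trans (((key k).2 k le_rfl t ht).trans_eq (by ring))
  have hlim : ∀ t, ∃ y, t ∈ I → Tendsto (fun k => x k t) atTop (𝓝 y) := by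
    intro t
    by_cases ht : t ∈ I
    · obtain ⟨y, hy⟩ := cauchySeq_tendsto_of_complete
        (cauchySeq_of_le_geometric q _ hq1 (hdiff t ht))
      exact ⟨y, fun _ => hy⟩
    · exact ⟨0, fun h => absurd h ht⟩
  choose u hu using hlim
  have hrate : ∀ t ∈ I, ∀ k, ‖x k t - u t‖ ≤ C * W t * q ^ k / (1 - q) := fun t ht k => by
    rw [← dist_eq_norm]
    exact dist_le_of_le_geometric_of_tendsto q _ hq1 (hdiff t ht) (hu t ht) k
  have hucont : ContinuousOn u I := by
    have hloc : TendstoLocallyUniformlyOn x u atTop I := by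
      rw [Metric.tendstoLocallyUniformlyOn_iff]
      intro ε hε t ht
      have hWt : ∀ᶠ s in 𝓝[I] t, W s < W t + 1 := (hW t ht).eventually (gt_mem_nhds (by linarith))
      refine ⟨{s ∈ I | W s < W t + 1}, by
        filter_upwards [hWt, self_mem_nhdsWithin] with s h1 h2 using ⟨h2, h1⟩, ?_⟩
      have hlim0 : Tendsto (fun k : ℕ => C * (W t + 1) * q ^ k / (1 - q)) atTop (𝓝 0) := by
        have := ((tendsto_pow_atTop_nhds_zero_of_lt_one hq0 hq1).const_mul
          (C * (W t + 1))).div_const (1 - q)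
        simpa using this
      filter_upwards [hlim0.eventually (gt_mem_nhds hε)] with k hk s hs
      rw [dist_comm, dist_eq_norm]
      refine lt_of_le_of_lt ((hrate s hs.1 k).trans ?_) hk
      have := hs.2.le
      gcongr
    exact hloc.continuousOn (Frequently.of_forall fun k => (hcls k).1)
  have hucls : InWeightedClass I W N u₀ u := by
    refine ⟨hucont, |c| * (C / (1 - q)), fun t ht => ?_⟩
    have := hrate t ht 0
    rw [hx0, pow_zero, norm_sub_rev] at this
    refine (hNbound _ _ this).trans_eq ?_
    field_simp
  refine ⟨u, hucls, fun t ht => ?_, fun t ht => hu t ht⟩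
  have h1 : ∀ k, ‖x (k + 1) t - T u t‖ ≤ q * (|c| * (C * q ^ k / (1 - q))) * W t := by
    intro k
    rw [hxs]
    refine (hN1 _).trans (hc _ _ (hcls k) hucls _ (fun s hs => ?_) t ht)
    refine (hNbound _ _ (hrate s hs k)).trans_eq ?_
    ring
  have h2 : Tendsto (fun k => x (k + 1) t) atTop (𝓝 (T u t)) := by
    rw [tendsto_iff_norm_sub_tendsto_zero]
    refine squeeze_zero (fun _ => norm_nonneg _) h1 ?_
    have := ((((tendsto_pow_atTop_nhds_zero_of_lt_one hq0 hq1).const_mul C).div_const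
      (1 - q)).const_mul (|c|)).const_mul q |>.mul_const (W t)
    simpa using this
  exact tendsto_nhds_unique ((tendsto_add_atTop_iff_nat 1).2 (hu t ht)) h2

theorem eqOn_of_weighted_contraction {I : Set ℝ} {W : ℝ → ℝ} {N : E → ℝ}
    (hN1 : ∀ z, ‖z‖ ≤ N z) {q : ℝ} (hq0 : 0 ≤ q) (hq1 : q < 1) {u v : ℝ → E}
    (hc : ∀ C, (∀ t ∈ I, N (u t - v t) ≤ C * W t) → ∀ t ∈ I, N (u t - v t) ≤ q * C * W t)
    (hb : ∃ C, ∀ t ∈ I, N (u t - v t) ≤ C * W t) : EqOn u v I := by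
  obtain ⟨C, hC⟩ := hb
  have h : ∀ k : ℕ, ∀ t ∈ I, N (u t - v t) ≤ q ^ k * C * W t := by
    intro k
    induction k with
    | zero => simpa using hC
    | succ k ih =>
      intro t ht
      exact (hc _ ih t ht).trans_eq (by ring)
  intro t ht
  have hlim : Tendsto (fun k : ℕ => q ^ k * C * W t) atTop (𝓝 0) := by
    simpa using ((tendsto_pow_atTop_nhds_zero_of_lt_one hq0 hq1).mul_const C).mul_const (W t)
  have := ge_of_tendsto' hlim fun k => (hN1 _).trans (h k t ht)
  exact sub_eq_zero.1 (norm_le_zero_iff.1 this)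

end WeightedContraction

/-! ### Global solutions of Lipschitz differential equations -/

section LipschitzODE

open Filter Topology NNReal

variable {E : Type*} [NormedAddCommGroup E] [NormedSpace ℝ E]

/-- Every Lipschitz time-dependent vector field has a global forward solution. A single application
of the contraction principle suffices, because the weight `e^{(K+1)t} (1 + ∫₀ᵗ ‖V(s, z)‖ ds)` is
adapted to the possible growth of the vector field in time. -/
theorem exists_forward_solution [CompleteSpace E] {V : ℝ → E → E}
    (hV : Continuous (Function.uncurry V)) {K : ℝ≥0} (hK : ∀ t, LipschitzWith K (V t)) (z : E) :
    ∃ Z : ℝ → E, Z 0 = z ∧ ∀ t, 0 ≤ t → HasDerivWithinAt Z (V t (Z t)) (Ici 0) t := by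
  set M : ℝ → ℝ := fun t => 1 + ∫ s in (0 : ℝ)..t, ‖V s z‖ with hM
  have hVz : Continuous fun s => ‖V s z‖ := (hV.comp (Continuous.prodMk_left z)).norm
  have hMc : Continuous M := continuous_const.add
    (intervalIntegral.continuous_primitive (fun a b => hVz.intervalIntegrable a b) 0)
  have hMmono : ∀ s t, 0 ≤ s → s ≤ t → M s ≤ M t := fun s t hs hst => by
    have : (∫ r in (0 : ℝ)..t, ‖V r z‖) - ∫ r in (0 : ℝ)..s, ‖V r z‖ = ∫ r in s..t, ‖V r z‖ :=
      intervalIntegral.integral_interval_sub_left (hVz.intervalIntegrable _ _)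
        (hVz.intervalIntegrable _ _)
    have h2 : 0 ≤ ∫ r in s..t, ‖V r z‖ :=
      intervalIntegral.integral_nonneg hst fun _ _ => norm_nonneg _
    simp only [hM]; linarith
  have hM1 : ∀ t, 0 ≤ t → 1 ≤ M t := fun t ht => by
    have := hMmono 0 t le_rfl ht
    simpa [hM] using this
  set c : ℝ := K + 1 with hcdef
  have hcpos : 0 < c := by positivity
  set W : ℝ → ℝ := fun t => Real.exp (c * t) * M t with hW
  have hWc : Continuous W := by fun_prop
  have hcomp : ∀ u : ℝ → E, ContinuousOn u (Ici 0) → ContinuousOn (fun s => V s (u s)) (Ici 0) :=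
    fun u hu => hV.comp_continuousOn (continuousOn_id.prodMk hu)
  have hint : ∀ u : ℝ → E, ContinuousOn u (Ici 0) → ∀ t, 0 ≤ t →
      IntervalIntegrable (fun s => V s (u s)) volume 0 t := fun u hu t ht =>
    ((hcomp u hu).mono (by rw [uIcc_of_le ht]; exact Icc_subset_Ici_self)).intervalIntegrable
  set T : (ℝ → E) → ℝ → E := fun u t => z + ∫ s in (0 : ℝ)..t, V s (u s) with hT
  have hderiv : ∀ u : ℝ → E, ContinuousOn u (Ici 0) → ∀ t, 0 ≤ t →
      HasDerivWithinAt (T u) (V t (u t)) (Ici 0) t := by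
    intro u hu t ht
    have h1 : HasDerivWithinAt (fun t => ∫ s in (0 : ℝ)..t, V s (u s)) (V t (u t))
        (Icc 0 (t + 1)) t := by
      have hmem : t ∈ Icc 0 (t + 1) := ⟨ht, by linarith⟩
      have : Fact (t ∈ Icc 0 (t + 1)) := ⟨hmem⟩
      have hco := (hcomp u hu).mono (Icc_subset_Ici_self : Icc 0 (t + 1) ⊆ Ici 0)
      exact intervalIntegral.integral_hasDerivWithinAt_right (hint u hu t ht)
        (hco.stronglyMeasurableAtFilter_nhdsWithin measurableSet_Icc t) (hco t hmem)
    have h2 : HasDerivWithinAt (fun t => ∫ s in (0 : ℝ)..t, V s (u s)) (V t (u t)) (Ici 0) t := by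
      refine h1.mono_of_mem_nhdsWithin ?_
      rw [← Ici_inter_Iic]
      exact inter_mem self_mem_nhdsWithin (mem_nhdsWithin_of_mem_nhds (Iic_mem_nhds (by linarith)))
    exact h2.const_add z
  obtain ⟨Z, hZ, hfix, -⟩ := exists_fixedPoint_of_weighted_contraction (I := Ici 0) (W := W)
    (N := fun z : E => ‖z‖) (c := 1) (q := K / c) hWc.continuousOn
    (fun t ht => mul_nonneg (Real.exp_nonneg _) (zero_le_one.trans (hM1 t ht)))
    (fun _ => le_rfl) (fun z => (one_mul ‖z‖).ge) (by positivity)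
    ((div_lt_one hcpos).2 (by simp [hcdef])) T (fun _ => z) continuousOn_const
    (fun u hu t ht => (hderiv u hu.1 t ht).continuousWithinAt)
    ⟨1, fun t ht => by
      have h1 : ‖∫ s in (0 : ℝ)..t, V s z‖ ≤ ∫ s in (0 : ℝ)..t, ‖V s z‖ :=
        intervalIntegral.norm_integral_le_integral_norm ht
      have h2 : 1 ≤ Real.exp (c * t) := Real.one_le_exp (mul_nonneg hcpos.le ht)
      have h3 : M t ≤ W t := le_mul_of_one_le_left (zero_le_one.trans (hM1 t ht)) h2
      simp only [hT, add_sub_cancel_left, one_mul]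
      simp only [hM] at h3 ⊢
      linarith⟩
    (by
      intro u v hu hv C hC t ht
      have hC0 : 0 ≤ C := by
        by_contra h
        have h1 := (norm_nonneg _).trans (hC 0 (mem_Ici.2 le_rfl))
        simp [hW, hM] at h1
        exact h h1
      have hMt : 0 ≤ M t := zero_le_one.trans (hM1 t ht)
      have hsub : T u t - T v t = ∫ s in (0 : ℝ)..t, (V s (u s) - V s (v s)) := by
        rw [intervalIntegral.integral_sub (hint u hu.1 t ht) (hint v hv.1 t ht)]
        simp [hT]
      rw [hsub]
      have hb : ∀ s ∈ Ioc 0 t, ‖V s (u s) - V s (v s)‖ ≤ K * C * M t * Real.exp (c * s) := by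
        intro s hs
        refine ((hK s).norm_sub_le (u s) (v s)).trans ?_
        have h1 := hC s hs.1.le
        have h2 : W s ≤ Real.exp (c * s) * M t :=
          mul_le_mul_of_nonneg_left (hMmono s t hs.1.le hs.2) (Real.exp_nonneg _)
        calc (K : ℝ) * ‖u s - v s‖ ≤ K * (C * (Real.exp (c * s) * M t)) := by
              gcongr
              exact h1.trans (by gcongr)
          _ = _ := by ring
      refine (intervalIntegral.norm_integral_le_of_norm_le ht
        (g := fun s => K * C * M t * Real.exp (c * s)) (ae_of_all _ hb)
        ((by fun_prop : Continuous fun s => K * C * M t * Real.exp (c * s)).intervalIntegrable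
          _ _)).trans ?_
      have hexp : (∫ s in (0 : ℝ)..t, Real.exp (c * s)) = (Real.exp (c * t) - 1) / c := by
        rw [intervalIntegral.integral_comp_mul_left (fun x => Real.exp x) hcpos.ne']
        simp [div_eq_inv_mul]
      rw [intervalIntegral.integral_const_mul, hexp]
      calc (K : ℝ) * C * M t * ((Real.exp (c * t) - 1) / c)
          ≤ K * C * M t * (Real.exp (c * t) / c) := by gcongr; linarith
        _ = _ := by simp only [hW]; ring)
  refine ⟨Z, ?_, fun t ht => ?_⟩
  · rw [hfix 0 (mem_Ici.2 le_rfl)]; simp [hT]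
  · have h1 := hderiv Z hZ.1 t ht
    exact h1.congr (fun s hs => hfix s hs) (hfix t ht)

/-- Continuous dependence of forward solutions on the initial value. -/
theorem dist_forward_solution_le {V : ℝ → E → E} {K : ℝ≥0} (hK : ∀ t, LipschitzWith K (V t))
    {Z Z' : ℝ → E} (hZ : ∀ t, 0 ≤ t → HasDerivWithinAt Z (V t (Z t)) (Ici 0) t)
    (hZ' : ∀ t, 0 ≤ t → HasDerivWithinAt Z' (V t (Z' t)) (Ici 0) t) {t : ℝ} (ht : 0 ≤ t) :
    dist (Z t) (Z' t) ≤ dist (Z 0) (Z' 0) * Real.exp (K * t) := by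
  have hcont : ∀ {Z : ℝ → E}, (∀ t, 0 ≤ t → HasDerivWithinAt Z (V t (Z t)) (Ici 0) t) →
      ContinuousOn Z (Icc 0 t) := fun h s hs =>
    ((h s hs.1).continuousWithinAt).mono Icc_subset_Ici_self
  have := dist_le_of_trajectories_ODE (a := 0) (b := t) (δ := dist (Z 0) (Z' 0)) hK (hcont hZ)
    (fun s hs => (hZ s hs.1).mono (Ici_subset_Ici.2 hs.1)) (hcont hZ')
    (fun s hs => (hZ' s hs.1).mono (Ici_subset_Ici.2 hs.1)) le_rfl t ⟨ht, le_rfl⟩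
  simpa using this

end LipschitzODE

/-! ### Linear semigroups and variation of constants -/

section Semigroup

open NormedSpace Filter Topology

theorem exp_zero_smul_apply {E : Type*} [NormedAddCommGroup E] [NormedSpace ℝ E]
    (T : E →L[ℝ] E) (x : E) : exp ((0 : ℝ) • T) x = x := by
  let _ : NormedAlgebra ℚ (E →L[ℝ] E) := NormedAlgebra.restrictScalars ℚ ℝ _
  rw [zero_smul, exp_zero]
  rfl

variable {E : Type*} [NormedAddCommGroup E] [NormedSpace ℝ E] [CompleteSpace E]

theorem exp_add_smul_apply (T : E →L[ℝ] E) (s t : ℝ) (x : E) :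
    exp ((s + t) • T) x = exp (s • T) (exp (t • T) x) := by
  let _ : NormedAlgebra ℚ (E →L[ℝ] E) := NormedAlgebra.restrictScalars ℚ ℝ _
  rw [add_smul, exp_add_of_commute (((Commute.refl T).smul_left s).smul_right t)]
  rfl

theorem hasDerivAt_exp_smul_clm (T : E →L[ℝ] E) (t : ℝ) :
    HasDerivAt (fun u : ℝ => exp (u • T)) (T * exp (t • T)) t :=
  hasDerivAt_exp_smul_const' (𝕂 := ℝ) T t

theorem continuous_exp_smul_clm (T : E →L[ℝ] E) : Continuous fun u : ℝ => exp (u • T) :=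
  continuous_iff_continuousAt.2 fun t => (hasDerivAt_exp_smul_clm T t).continuousAt

theorem apply_exp_smul_comm (T : E →L[ℝ] E) (t : ℝ) (x : E) :
    T (exp (t • T) x) = exp (t • T) (T x) := by
  have h := (hasDerivAt_exp_smul_const (𝕂 := ℝ) T t).unique (hasDerivAt_exp_smul_clm T t)
  exact (DFunLike.congr_fun h x).symm

theorem hasDerivAt_exp_smul_apply (T : E →L[ℝ] E) (x : E) (t : ℝ) :
    HasDerivAt (fun u : ℝ => exp (u • T) x) (T (exp (t • T) x)) t :=
  by simpa using (hasDerivAt_exp_smul_clm T t).clm_apply (hasDerivAt_const t x)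

/-- The fundamental theorem of calculus on a half-line. -/
theorem hasDerivWithinAt_integral_Iic {p : ℝ → E} (hp : ContinuousOn p (Iic 0)) {t : ℝ}
    (ht : t ≤ 0) : HasDerivWithinAt (fun t => ∫ s in (0 : ℝ)..t, p s) (p t) (Iic 0) t := by
  have hmem : t ∈ Icc (t - 1) 0 := ⟨by linarith, ht⟩
  have : Fact (t ∈ Icc (t - 1) 0) := ⟨hmem⟩
  have hco := hp.mono (Icc_subset_Iic_self : Icc (t - 1) 0 ⊆ Iic 0)
  have h1 : HasDerivWithinAt (fun t => ∫ s in (0 : ℝ)..t, p s) (p t) (Icc (t - 1) 0) t :=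
    intervalIntegral.integral_hasDerivWithinAt_right
      (hp.mono (by rw [uIcc_of_ge ht]; exact Icc_subset_Iic_self)).intervalIntegrable
      (hco.stronglyMeasurableAtFilter_nhdsWithin measurableSet_Icc t) (hco t hmem)
  refine h1.mono_of_mem_nhdsWithin ?_
  rw [← Ici_inter_Iic]
  exact inter_mem (mem_nhdsWithin_of_mem_nhds (Ici_mem_nhds (by linarith))) self_mem_nhdsWithin

theorem continuousOn_exp_smul_apply {T : E →L[ℝ] E} {p : ℝ → E} {I : Set ℝ} {r : ℝ → ℝ}
    (hr : Continuous r) (hp : ContinuousOn p I) :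
    ContinuousOn (fun s => exp (r s • T) (p s)) I :=
  ((continuous_exp_smul_clm T).comp hr).continuousOn.clm_apply hp

/-- `t ↦ e^{tT} (y₀ + ∫₀ᵗ e^{-sT} p(s) ds)` solves `ẏ = T y + p` on `(-∞, 0]`. -/
theorem hasDerivWithinAt_exp_smul_integral (T : E →L[ℝ] E) {p : ℝ → E}
    (hp : ContinuousOn p (Iic 0)) (y₀ : E) {t : ℝ} (ht : t ≤ 0) :
    HasDerivWithinAt
      (fun t : ℝ => exp (t • T) (y₀ + ∫ s in (0 : ℝ)..t, exp ((-s) • T) (p s)))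
      (T (exp (t • T) (y₀ + ∫ s in (0 : ℝ)..t, exp ((-s) • T) (p s))) + p t) (Iic 0) t := by
  have h1 := (hasDerivWithinAt_integral_Iic
    (continuousOn_exp_smul_apply (T := T) continuous_neg hp) ht).const_add y₀
  have h2 := (hasDerivAt_exp_smul_clm T t).hasDerivWithinAt (s := Iic 0) |>.clm_apply h1
  convert h2 using 2
  · rfl
  · rw [← exp_add_smul_apply, add_neg_cancel, exp_zero_smul_apply]

/-- The variation of constants formula. -/
theorem variation_of_constants (T : E →L[ℝ] E) {x p : ℝ → E} {a b : ℝ} (hab : a ≤ b)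
    (hp : ContinuousOn p (Icc a b))
    (hx : ∀ t ∈ Icc a b, HasDerivWithinAt x (T (x t) + p t) (Icc a b) t) (c : ℝ) :
    (∫ s in a..b, exp ((c - s) • T) (p s)) =
      exp ((c - b) • T) (x b) - exp ((c - a) • T) (x a) := by
  have hder : ∀ t ∈ Icc a b, HasDerivWithinAt (fun s => exp ((c - s) • T) (x s))
      (exp ((c - t) • T) (p t)) (Icc a b) t := by
    intro t ht
    have h1 : HasDerivAt (fun s : ℝ => exp ((c - s) • T)) (-(T * exp ((c - t) • T))) t := by
      have := (hasDerivAt_exp_smul_clm T (c - t)).scomp t ((hasDerivAt_id t).const_sub c)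
      simpa [Function.comp_def] using this
    have h2 := h1.hasDerivWithinAt (s := Icc a b) |>.clm_apply (hx t ht)
    convert h2 using 1
    have := apply_exp_smul_comm T (c - t) (x t)
    simp only [neg_apply, mul_apply_eq_comp, map_add, this]
    abel
  refine intervalIntegral.integral_eq_sub_of_hasDerivAt_of_le hab
    (fun t ht => (hder t ht).continuousWithinAt)
    (fun t ht => (hder t (Ioo_subset_Icc_self ht)).hasDerivAt (Icc_mem_nhds ht.1 ht.2)) ?_
  refine ContinuousOn.intervalIntegrable ?_
  rw [uIcc_of_le hab]
  exact continuousOn_exp_smul_apply (T := T) (continuous_sub_left c) hp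

end Semigroup

section SemigroupForm

open NormedSpace Filter Topology

variable {E : Type*} [NormedAddCommGroup E] [InnerProductSpace ℝ E] [CompleteSpace E]

theorem nonpos_of_hasDerivAt_of_nonneg_left {ψ : ℝ → ℝ} {d : ℝ} (h : HasDerivAt ψ d 0)
    (h0 : ψ 0 = 0) (hψ : ∀ t ≤ 0, 0 ≤ ψ t) : d ≤ 0 := by
  have h1 := (hasDerivWithinAt_iff_tendsto_slope' (s := Iio 0) (by simp)).1
    (h.hasDerivWithinAt (s := Iio 0))
  refine le_of_tendsto h1 ?_
  filter_upwards [self_mem_nhdsWithin] with t ht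
  rw [slope_def_field, h0]
  have ht' : t < 0 := ht
  exact div_nonpos_of_nonneg_of_nonpos (by simpa using hψ t ht'.le) (by simpa using ht'.le)

/-- An exponential bound on the backward semigroup bounds the quadratic form of its generator. -/
theorem inner_ge_of_exp_bound {T : E →L[ℝ] E} {α : ℝ}
    (h : ∀ t : ℝ, t ≤ 0 → ∀ x : E, ‖exp (t • T) x‖ ≤ Real.exp (α * t) * ‖x‖) (x : E) :
    α * ‖x‖ ^ 2 ≤ inner ℝ x (T x) := by
  have hd1 : HasDerivAt (fun t : ℝ => ‖exp (t • T) x‖ ^ 2) (2 * inner ℝ x (T x)) 0 := by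
    have := (hasDerivAt_exp_smul_apply T x 0).norm_sq
    rwa [exp_zero_smul_apply] at this
  have hd2 : HasDerivAt (fun t : ℝ => (Real.exp (α * t) * ‖x‖) ^ 2) (2 * α * ‖x‖ ^ 2) 0 := by
    have h1 : HasDerivAt (fun t : ℝ => α * t) α 0 := by
      simpa using (hasDerivAt_id (0 : ℝ)).const_mul α
    refine ((h1.exp.mul_const ‖x‖).pow 2).congr_deriv ?_
    simp
    ring
  have := nonpos_of_hasDerivAt_of_nonneg_left (hd2.sub hd1)
    (by simp [-zero_smul, exp_zero_smul_apply])
    (fun t ht => sub_nonneg.2 (pow_le_pow_left₀ (norm_nonneg _) (h t ht x) 2))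
  linarith

theorem inner_le_of_exp_bound {T : E →L[ℝ] E} {β : ℝ}
    (h : ∀ t : ℝ, 0 ≤ t → ∀ x : E, ‖exp (t • T) x‖ ≤ Real.exp (β * t) * ‖x‖) (x : E) :
    inner ℝ x (T x) ≤ β * ‖x‖ ^ 2 := by
  have := inner_ge_of_exp_bound (T := -T) (α := -β) (fun t ht x => by
    simpa using h (-t) (by linarith) x) x
  rw [neg_apply, inner_neg_right] at this
  linarith

end SemigroupForm

/-! ### Split systems and the Lyapunov-Perron map -/

/-- The norm `‖x‖ + ‖y‖` on a product. -/
def l1Norm {E₁ E₂ : Type*} [Norm E₁] [Norm E₂] (z : E₁ × E₂) : ℝ := ‖z.1‖ + ‖z.2‖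

/-- A nonautonomous system `ẋ = A x + F(t, x, y)`, `ẏ = B y + G(t, x, y)` with Lipschitz
nonlinearities, in which `e^{tA}` contracts by `e^{αt}` backwards in time and `e^{tB}` contracts by
`e^{βt}` forwards in time. For almost every noise path, the random slow-fast system is of this
form, with the factor `ε⁻¹` absorbed into `B`, `G`, `β` and `L₂`. -/
structure SplitSystem (E₁ E₂ : Type*) [NormedAddCommGroup E₁] [NormedSpace ℝ E₁]
    [NormedAddCommGroup E₂] [NormedSpace ℝ E₂] where
  A : E₁ →L[ℝ] E₁
  B : E₂ →L[ℝ] E₂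
  F : ℝ → E₁ × E₂ → E₁
  G : ℝ → E₁ × E₂ → E₂
  α : ℝ
  β : ℝ
  L₁ : ℝ
  L₂ : ℝ
  L₁_nonneg : 0 ≤ L₁
  L₂_nonneg : 0 ≤ L₂
  continuous_F : Continuous (Function.uncurry F)
  continuous_G : Continuous (Function.uncurry G)
  F_lipschitz : ∀ t z z', ‖F t z - F t z'‖ ≤ L₁ * l1Norm (z - z')
  G_lipschitz : ∀ t z z', ‖G t z - G t z'‖ ≤ L₂ * l1Norm (z - z')
  exp_A_le : ∀ t : ℝ, t ≤ 0 → ∀ x, ‖NormedSpace.exp (t • A) x‖ ≤ Real.exp (α * t) * ‖x‖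
  exp_B_le : ∀ t : ℝ, 0 ≤ t → ∀ y, ‖NormedSpace.exp (t • B) y‖ ≤ Real.exp (β * t) * ‖y‖

section L1Norm

variable {E₁ E₂ : Type*} [NormedAddCommGroup E₁] [NormedAddCommGroup E₂]

theorem norm_le_l1Norm (z : E₁ × E₂) : ‖z‖ ≤ l1Norm z :=
  max_le (le_add_of_nonneg_right (norm_nonneg _)) (le_add_of_nonneg_left (norm_nonneg _))

theorem l1Norm_le_two_mul_norm (z : E₁ × E₂) : l1Norm z ≤ 2 * ‖z‖ := by
  have h1 := norm_fst_le z
  have h2 := norm_snd_le z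
  unfold l1Norm
  linarith

theorem l1Norm_sub_le (z z' : E₁ × E₂) : l1Norm (z - z') ≤ l1Norm z + l1Norm z' := by
  have h1 := norm_sub_le z.1 z'.1
  have h2 := norm_sub_le z.2 z'.2
  simp only [l1Norm, Prod.fst_sub, Prod.snd_sub]
  linarith

theorem continuous_l1Norm : Continuous (l1Norm : E₁ × E₂ → ℝ) :=
  (continuous_norm.comp continuous_fst).add (continuous_norm.comp continuous_snd)

/-- The space `C_μ⁻` of continuous functions on `(-∞, 0]` which are `O(e^{μt})`. -/
def BackwardBounded (μ : ℝ) (u : ℝ → E₁ × E₂) : Prop :=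
  ContinuousOn u (Iic 0) ∧ ∃ C, ∀ t ≤ 0, l1Norm (u t) ≤ C * Real.exp (μ * t)

variable {μ : ℝ}

theorem BackwardBounded.mono {ν : ℝ} (h : ν ≤ μ) {u : ℝ → E₁ × E₂} (hu : BackwardBounded μ u) :
    BackwardBounded ν u := by
  obtain ⟨hc, C, hC⟩ := hu
  refine ⟨hc, |C|, fun t ht => (hC t ht).trans ?_⟩
  exact mul_le_mul (le_abs_self C) (Real.exp_le_exp.2 (mul_le_mul_of_nonpos_right h ht))
    (Real.exp_nonneg _) (abs_nonneg C)

theorem BackwardBounded.exists_sub_le {u v : ℝ → E₁ × E₂} (hu : BackwardBounded μ u)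
    (hv : BackwardBounded μ v) :
    ∃ C, ∀ t ≤ 0, l1Norm (u t - v t) ≤ C * Real.exp (μ * t) := by
  obtain ⟨-, C, hC⟩ := hu
  obtain ⟨-, D, hD⟩ := hv
  refine ⟨C + D, fun t ht => (l1Norm_sub_le _ _).trans ?_⟩
  rw [add_mul]
  exact add_le_add (hC t ht) (hD t ht)

theorem inWeightedClass_zero_iff {u : ℝ → E₁ × E₂} :
    InWeightedClass (Iic 0) (fun t => Real.exp (μ * t)) l1Norm (fun _ => 0) u ↔
      BackwardBounded μ u := by
  simp [InWeightedClass, BackwardBounded]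

theorem BackwardBounded.of_le {τ C : ℝ} {u : ℝ → E₁ × E₂} (hu : ContinuousOn u (Iic 0))
    (hC : ∀ t ≤ τ, l1Norm (u t) ≤ C * Real.exp (μ * t)) : BackwardBounded μ u := by
  have hc : ContinuousOn (fun t => Real.exp (-(μ * t)) * l1Norm (u t)) (Icc τ 0) :=
    (by fun_prop : Continuous fun t => Real.exp (-(μ * t))).continuousOn.mul
      (continuous_l1Norm.comp_continuousOn (hu.mono Icc_subset_Iic_self))
  obtain ⟨D, hD⟩ := isCompact_Icc.bddAbove_image hc
  refine ⟨hu, max C D, fun t ht => ?_⟩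
  rcases le_total t τ with h | h
  · exact (hC t h).trans (mul_le_mul_of_nonneg_right (le_max_left _ _) (Real.exp_nonneg _))
  · have h1 : Real.exp (-(μ * t)) * l1Norm (u t) ≤ max C D :=
      (hD ⟨t, ⟨h, ht⟩, rfl⟩).trans (le_max_right _ _)
    rwa [Real.exp_neg, inv_mul_le_iff₀ (Real.exp_pos _), mul_comm] at h1

end L1Norm

namespace SplitSystem

open NormedSpace Filter Topology

variable {E₁ E₂ : Type*} [NormedAddCommGroup E₁] [NormedSpace ℝ E₁]
  [NormedAddCommGroup E₂] [NormedSpace ℝ E₂] (N : SplitSystem E₁ E₂)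

/-- The right-hand side of the system. -/
def vectorField (t : ℝ) (z : E₁ × E₂) : E₁ × E₂ := (N.A z.1 + N.F t z, N.B z.2 + N.G t z)

/-- `Z` solves the system on the time set `I`. -/
def IsSolutionOn (I : Set ℝ) (Z : ℝ → E₁ × E₂) : Prop :=
  ∀ t ∈ I, HasDerivWithinAt Z (N.vectorField t (Z t)) I t

/-- The system with time translated by `τ`. -/
def shift (τ : ℝ) : SplitSystem E₁ E₂ :=
  { N with
    F := fun t => N.F (t + τ)
    G := fun t => N.G (t + τ)
    continuous_F := N.continuous_F.comp
      ((continuous_fst.add continuous_const).prodMk continuous_snd)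
    continuous_G := N.continuous_G.comp
      ((continuous_fst.add continuous_const).prodMk continuous_snd)
    F_lipschitz := fun t => N.F_lipschitz (t + τ)
    G_lipschitz := fun t => N.G_lipschitz (t + τ) }

/-- The spectral gap condition at the rate `μ`. -/
def HasGap (μ : ℝ) : Prop :=
  N.β < μ ∧ μ < N.α ∧ N.L₁ / (N.α - μ) + N.L₂ / (μ - N.β) < 1

/-- The forcing `(F, G)(s, 0)` is integrable on `(-∞, 0]` against the weight `e^{-μs}`. -/
def ForcingIntegrable (μ : ℝ) : Prop :=
  IntegrableOn (fun s => Real.exp (-(μ * s)) * (‖N.F s 0‖ + ‖N.G s 0‖)) (Iic 0)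

/-- The Lyapunov-Perron map. -/
noncomputable def perron (x₀ : E₁) (u : ℝ → E₁ × E₂) (t : ℝ) : E₁ × E₂ :=
  (exp (t • N.A) x₀ + ∫ s in (0 : ℝ)..t, exp ((t - s) • N.A) (N.F s (u s)),
    ∫ s in Iic t, exp ((t - s) • N.B) (N.G s (u s)))

/-- `u` is a fixed point in `C_μ⁻` of the Lyapunov-Perron map. -/
def IsPerronOrbit (μ : ℝ) (x₀ : E₁) (u : ℝ → E₁ × E₂) : Prop :=
  BackwardBounded μ u ∧ ∀ t ≤ 0, u t = N.perron x₀ u t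

variable {N} {μ : ℝ}

theorem IsPerronOrbit.mono {ν : ℝ} (h : ν ≤ μ) {x₀ : E₁} {u : ℝ → E₁ × E₂}
    (hu : N.IsPerronOrbit μ x₀ u) : N.IsPerronOrbit ν x₀ u :=
  ⟨hu.1.mono h, hu.2⟩

theorem continuousOn_F {u : ℝ → E₁ × E₂} {I : Set ℝ} (hu : ContinuousOn u I) :
    ContinuousOn (fun s => N.F s (u s)) I :=
  N.continuous_F.comp_continuousOn (continuousOn_id.prodMk hu)

theorem continuousOn_G {u : ℝ → E₁ × E₂} {I : Set ℝ} (hu : ContinuousOn u I) :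
    ContinuousOn (fun s => N.G s (u s)) I :=
  N.continuous_G.comp_continuousOn (continuousOn_id.prodMk hu)

theorem ForcingIntegrable.G (hF : N.ForcingIntegrable μ) :
    IntegrableOn (fun s => Real.exp (-(μ * s)) * ‖N.G s 0‖) (Iic 0) := by
  refine hF.mono' ?_ (ae_of_all _ fun s => ?_)
  · exact ((by fun_prop : Continuous fun s => Real.exp (-(μ * s))).mul
      (N.continuous_G.comp (Continuous.prodMk_left 0)).norm).aestronglyMeasurable
  · rw [Real.norm_of_nonneg (by positivity)]
    gcongr
    exact le_add_of_nonneg_left (norm_nonneg _)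

theorem ForcingIntegrable.F (hF : N.ForcingIntegrable μ) :
    IntegrableOn (fun s => Real.exp (-(μ * s)) * ‖N.F s 0‖) (Iic 0) := by
  refine hF.mono' ?_ (ae_of_all _ fun s => ?_)
  · exact ((by fun_prop : Continuous fun s => Real.exp (-(μ * s))).mul
      (N.continuous_F.comp (Continuous.prodMk_left 0)).norm).aestronglyMeasurable
  · rw [Real.norm_of_nonneg (by positivity)]
    gcongr
    exact le_add_of_nonneg_right (norm_nonneg _)

/-- The forcing of the fast variable along a function of `C_μ⁻` is integrable against `e^{-βs}`. -/
theorem integrableOn_exp_mul_norm_G (hμ : N.β < μ) (hF : N.ForcingIntegrable μ)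
    {u : ℝ → E₁ × E₂} (hu : BackwardBounded μ u) :
    IntegrableOn (fun s => Real.exp (-(N.β * s)) * ‖N.G s (u s)‖) (Iic 0) := by
  obtain ⟨hc, C, hC⟩ := hu
  have hdom : IntegrableOn (fun s => Real.exp (-(μ * s)) * ‖N.G s 0‖ +
      N.L₂ * C * Real.exp ((μ - N.β) * s)) (Iic 0) :=
    hF.G.add ((integrableOn_exp_mul_Iic (sub_pos.2 hμ) 0).const_mul _)
  refine hdom.mono' (ContinuousOn.aestronglyMeasurable ?_ measurableSet_Iic) ?_
  · exact (by fun_prop : Continuous fun s => Real.exp (-(N.β * s))).continuousOn.mul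
      (continuousOn_G hc).norm
  · refine (ae_restrict_iff' measurableSet_Iic).2 (ae_of_all _ fun s hs => ?_)
    have hs : s ≤ 0 := hs
    rw [Real.norm_of_nonneg (by positivity)]
    have h1 : ‖N.G s (u s)‖ ≤ ‖N.G s 0‖ + N.L₂ * (C * Real.exp (μ * s)) := by
      have h2 := N.G_lipschitz s (u s) 0
      rw [sub_zero] at h2
      have h3 := norm_le_norm_add_norm_sub' (N.G s (u s)) (N.G s 0)
      have h4 := mul_le_mul_of_nonneg_left (hC s hs) N.L₂_nonneg
      linarith
    have h2 : Real.exp (-(N.β * s)) ≤ Real.exp (-(μ * s)) :=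
      Real.exp_le_exp.2 (by nlinarith)
    have h3 : Real.exp ((μ - N.β) * s) = Real.exp (-(N.β * s)) * Real.exp (μ * s) := by
      rw [← Real.exp_add]; ring_nf
    calc Real.exp (-(N.β * s)) * ‖N.G s (u s)‖
        ≤ Real.exp (-(N.β * s)) * (‖N.G s 0‖ + N.L₂ * (C * Real.exp (μ * s))) := by gcongr
      _ = Real.exp (-(N.β * s)) * ‖N.G s 0‖ + N.L₂ * C * Real.exp ((μ - N.β) * s) := by
          rw [h3]; ring
      _ ≤ _ := by gcongr

theorem norm_slow_integral_le (hμ : μ < N.α) {p : ℝ → E₁} {D t : ℝ} (ht : t ≤ 0)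
    (hD : ∀ s ≤ 0, ‖p s‖ ≤ D * Real.exp (μ * s)) :
    ‖∫ s in (0 : ℝ)..t, exp ((t - s) • N.A) (p s)‖ ≤ D / (N.α - μ) * Real.exp (μ * t) := by
  have hD0 : 0 ≤ D := by simpa using (norm_nonneg _).trans (hD 0 le_rfl)
  have hpos : 0 < N.α - μ := sub_pos.2 hμ
  rw [intervalIntegral.integral_symm, norm_neg]
  have hb : ∀ s ∈ Ioc t 0, ‖exp ((t - s) • N.A) (p s)‖ ≤
      D * Real.exp (N.α * t) * Real.exp ((μ - N.α) * s) := by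
    intro s hs
    refine (N.exp_A_le (t - s) (by linarith [hs.1]) (p s)).trans ?_
    refine (mul_le_mul_of_nonneg_left (hD s hs.2) (Real.exp_nonneg _)).trans_eq ?_
    rw [mul_left_comm, mul_assoc, ← Real.exp_add, ← Real.exp_add]
    ring_nf
  refine (intervalIntegral.norm_integral_le_of_norm_le ht
    (g := fun s => D * Real.exp (N.α * t) * Real.exp ((μ - N.α) * s)) (ae_of_all _ hb)
    ((by fun_prop : Continuous fun s => D * Real.exp (N.α * t) *
      Real.exp ((μ - N.α) * s)).intervalIntegrable _ _)).trans ?_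
  have hexp : (∫ s in t..(0 : ℝ), Real.exp ((μ - N.α) * s)) =
      (Real.exp ((μ - N.α) * t) - 1) / (N.α - μ) := by
    rw [intervalIntegral.integral_comp_mul_left (fun x => Real.exp x) (by linarith)]
    simp only [mul_zero, integral_exp, Real.exp_zero, smul_eq_mul]
    rw [← neg_sub N.α μ, inv_neg]
    field_simp
    ring
  rw [intervalIntegral.integral_const_mul, hexp]
  calc D * Real.exp (N.α * t) * ((Real.exp ((μ - N.α) * t) - 1) / (N.α - μ))
      ≤ D * Real.exp (N.α * t) * (Real.exp ((μ - N.α) * t) / (N.α - μ)) := by gcongr; linarith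
    _ = D / (N.α - μ) * (Real.exp (N.α * t) * Real.exp ((μ - N.α) * t)) := by ring
    _ = _ := by rw [← Real.exp_add]; ring_nf

theorem norm_slow_integral_le_of_weighted (hμ : μ ≤ N.α) {p : ℝ → E₁}
    (hpi : IntegrableOn (fun s => Real.exp (-(μ * s)) * ‖p s‖) (Iic 0)) {t : ℝ} (ht : t ≤ 0) :
    ‖∫ s in (0 : ℝ)..t, exp ((t - s) • N.A) (p s)‖ ≤
      (∫ s in Iic (0 : ℝ), Real.exp (-(μ * s)) * ‖p s‖) * Real.exp (μ * t) := by
  rw [intervalIntegral.integral_symm, norm_neg]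
  have hint : IntervalIntegrable (fun s => Real.exp (-(μ * s)) * ‖p s‖) volume t 0 :=
    (intervalIntegrable_iff_integrableOn_Ioc_of_le ht).2 (hpi.mono_set Ioc_subset_Iic_self)
  have hb : ∀ s ∈ Ioc t 0, ‖exp ((t - s) • N.A) (p s)‖ ≤
      Real.exp (μ * t) * (Real.exp (-(μ * s)) * ‖p s‖) := by
    intro s hs
    refine (N.exp_A_le (t - s) (by linarith [hs.1]) (p s)).trans ?_
    rw [← mul_assoc, ← Real.exp_add]
    gcongr
    nlinarith [hs.1]
  refine (intervalIntegral.norm_integral_le_of_norm_le ht (ae_of_all _ hb)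
    (hint.const_mul _)).trans ?_
  rw [intervalIntegral.integral_const_mul, mul_comm, intervalIntegral.integral_of_le ht]
  gcongr
  exact ae_of_all _ fun s => by positivity
  exact Ioc_subset_Iic_self

theorem norm_fast_integral_le (hμ : N.β < μ) {p : ℝ → E₂} {D t : ℝ} (ht : t ≤ 0)
    (hD : ∀ s ≤ 0, ‖p s‖ ≤ D * Real.exp (μ * s)) :
    ‖∫ s in Iic t, exp ((t - s) • N.B) (p s)‖ ≤ D / (μ - N.β) * Real.exp (μ * t) := by
  have hpos : 0 < μ - N.β := sub_pos.2 hμ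
  have hb : ∀ s ∈ Iic t, ‖exp ((t - s) • N.B) (p s)‖ ≤
      D * Real.exp (N.β * t) * Real.exp ((μ - N.β) * s) := by
    intro s hs
    refine (N.exp_B_le (t - s) (sub_nonneg.2 hs) (p s)).trans ?_
    refine (mul_le_mul_of_nonneg_left (hD s (le_trans hs ht)) (Real.exp_nonneg _)).trans_eq ?_
    rw [mul_left_comm, mul_assoc, ← Real.exp_add, ← Real.exp_add]
    ring_nf
  refine (norm_integral_le_of_norm_le ((integrableOn_exp_mul_Iic hpos t).const_mul _)
    ((ae_restrict_iff' measurableSet_Iic).2 (ae_of_all _ hb))).trans_eq ?_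
  rw [integral_const_mul, integral_exp_mul_Iic hpos]
  calc D * Real.exp (N.β * t) * (Real.exp ((μ - N.β) * t) / (μ - N.β))
      = D / (μ - N.β) * (Real.exp (N.β * t) * Real.exp ((μ - N.β) * t)) := by ring
    _ = _ := by rw [← Real.exp_add]; ring_nf

theorem norm_fast_integral_le_of_weighted (hμ : N.β ≤ μ) {p : ℝ → E₂}
    (hpi : IntegrableOn (fun s => Real.exp (-(μ * s)) * ‖p s‖) (Iic 0)) {t : ℝ} (ht : t ≤ 0) :
    ‖∫ s in Iic t, exp ((t - s) • N.B) (p s)‖ ≤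
      (∫ s in Iic (0 : ℝ), Real.exp (-(μ * s)) * ‖p s‖) * Real.exp (μ * t) := by
  have hsub : Iic t ⊆ Iic 0 := Iic_subset_Iic.2 ht
  have hb : ∀ s ∈ Iic t, ‖exp ((t - s) • N.B) (p s)‖ ≤
      Real.exp (μ * t) * (Real.exp (-(μ * s)) * ‖p s‖) := by
    intro s hs
    have hs' : s ≤ t := hs
    refine (N.exp_B_le (t - s) (sub_nonneg.2 hs) (p s)).trans ?_
    rw [← mul_assoc, ← Real.exp_add]
    gcongr
    nlinarith
  refine (norm_integral_le_of_norm_le ((hpi.mono_set hsub).const_mul _)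
    ((ae_restrict_iff' measurableSet_Iic).2 (ae_of_all _ hb))).trans ?_
  rw [integral_const_mul, mul_comm]
  gcongr
  exact ae_of_all _ fun s => by positivity

theorem l1Norm_perron_zero_le (hgap : N.HasGap μ) (hF : N.ForcingIntegrable μ)
    (x₀ : E₁) : ∃ C, ∀ t ≤ 0, l1Norm (N.perron x₀ (fun _ => 0) t) ≤
      C * Real.exp (μ * t) := by
  obtain ⟨hβ, hα, -⟩ := hgap
  refine ⟨‖x₀‖ + (∫ s in Iic (0 : ℝ), Real.exp (-(μ * s)) * ‖N.F s 0‖) +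
    ∫ s in Iic (0 : ℝ), Real.exp (-(μ * s)) * ‖N.G s 0‖, fun t ht => ?_⟩
  have b1 := norm_slow_integral_le_of_weighted hα.le hF.F ht
  have b2 := norm_fast_integral_le_of_weighted hβ.le hF.G ht
  have b3 : ‖exp (t • N.A) x₀‖ ≤ ‖x₀‖ * Real.exp (μ * t) := by
    refine (N.exp_A_le t ht x₀).trans ?_
    rw [mul_comm]
    gcongr ?_ * Real.exp ?_
    exact mul_le_mul_of_nonpos_right hα.le ht
  have b4 := norm_add_le (exp (t • N.A) x₀) (∫ s in (0 : ℝ)..t, exp ((t - s) • N.A) (N.F s 0))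
  simp only [l1Norm, perron]
  linarith

theorem integrableOn_exp_smul_of_weighted [CompleteSpace E₂] {p : ℝ → E₂}
    (hp : ContinuousOn p (Iic 0))
    (hpi : IntegrableOn (fun s => Real.exp (-(N.β * s)) * ‖p s‖) (Iic 0)) {t : ℝ} (ht : t ≤ 0) :
    IntegrableOn (fun s => exp ((t - s) • N.B) (p s)) (Iic t) := by
  have hsub : Iic t ⊆ Iic 0 := Iic_subset_Iic.2 ht
  refine ((hpi.mono_set hsub).const_mul (Real.exp (N.β * t))).mono'
    ((continuousOn_exp_smul_apply (continuous_sub_left t) (hp.mono hsub)).aestronglyMeasurable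
      measurableSet_Iic) ?_
  refine (ae_restrict_iff' measurableSet_Iic).2 (ae_of_all _ fun s hs => ?_)
  refine (N.exp_B_le (t - s) (sub_nonneg.2 hs) (p s)).trans_eq ?_
  rw [← mul_assoc, ← Real.exp_add]
  ring_nf

variable [CompleteSpace E₁] [CompleteSpace E₂]

theorem hasDerivWithinAt_perron (hμ : N.β < μ) (hF : N.ForcingIntegrable μ)
    {u : ℝ → E₁ × E₂} (hu : BackwardBounded μ u) (x₀ : E₁) {t : ℝ} (ht : t ≤ 0) :
    HasDerivWithinAt (N.perron x₀ u) (N.A (N.perron x₀ u t).1 + N.F t (u t),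
      N.B (N.perron x₀ u t).2 + N.G t (u t)) (Iic 0) t := by
  have hFc : ContinuousOn (fun s => N.F s (u s)) (Iic 0) := continuousOn_F hu.1
  have hGc : ContinuousOn (fun s => N.G s (u s)) (Iic 0) := continuousOn_G hu.1
  have hi : ∀ t ≤ 0, IntegrableOn (fun s => exp ((t - s) • N.B) (N.G s (u s))) (Iic t) :=
    fun t ht => integrableOn_exp_smul_of_weighted hGc (integrableOn_exp_mul_norm_G hμ hF hu) ht
  -- each component is of the form covered by `hasDerivWithinAt_exp_smul_integral`
  have h1 : ∀ t ≤ 0, (N.perron x₀ u t).1 =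
      exp (t • N.A) (x₀ + ∫ s in (0 : ℝ)..t, exp ((-s) • N.A) (N.F s (u s))) := by
    intro t ht
    have hint : IntervalIntegrable (fun s => exp ((-s) • N.A) (N.F s (u s))) volume 0 t :=
      ((continuousOn_exp_smul_apply continuous_neg hFc).mono
        (by rw [uIcc_of_ge ht]; exact Icc_subset_Iic_self)).intervalIntegrable
    rw [map_add, ← ContinuousLinearMap.intervalIntegral_comp_comm _ hint]
    simp only [perron, ← exp_add_smul_apply, sub_eq_add_neg]
  have h2 : ∀ t ≤ 0, (N.perron x₀ u t).2 =
      exp (t • N.B) ((∫ s in Iic (0 : ℝ), exp ((-s) • N.B) (N.G s (u s))) +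
        ∫ s in (0 : ℝ)..t, exp ((-s) • N.B) (N.G s (u s))) := by
    intro t ht
    have hint : IntegrableOn (fun s => exp ((-s) • N.B) (N.G s (u s))) (Iic 0) := by
      simpa using hi 0 le_rfl
    rw [← intervalIntegral.integral_Iic_sub_Iic hint (hint.mono_set (Iic_subset_Iic.2 ht)),
      add_sub_cancel, ← ContinuousLinearMap.integral_comp_comm _
        (hint.mono_set (Iic_subset_Iic.2 ht))]
    simp only [perron, ← exp_add_smul_apply, sub_eq_add_neg]
  have d1 := hasDerivWithinAt_exp_smul_integral N.A hFc x₀ ht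
  have d2 := hasDerivWithinAt_exp_smul_integral N.B hGc
    (∫ s in Iic (0 : ℝ), exp ((-s) • N.B) (N.G s (u s))) ht
  rw [← h1 t ht] at d1
  rw [← h2 t ht] at d2
  exact (d1.congr h1 (h1 t ht)).prodMk (d2.congr h2 (h2 t ht))

/-- The Lyapunov-Perron map contracts with the constant of the gap condition. -/
theorem l1Norm_perron_sub_le (hgap : N.HasGap μ) (hF : N.ForcingIntegrable μ) (x₀ : E₁)
    {u v : ℝ → E₁ × E₂} (hu : BackwardBounded μ u) (hv : BackwardBounded μ v) {C : ℝ}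
    (hC : ∀ t ≤ 0, l1Norm (u t - v t) ≤ C * Real.exp (μ * t)) {t : ℝ} (ht : t ≤ 0) :
    l1Norm (N.perron x₀ u t - N.perron x₀ v t) ≤
      (N.L₁ / (N.α - μ) + N.L₂ / (μ - N.β)) * C * Real.exp (μ * t) := by
  obtain ⟨hβ, hα, -⟩ := hgap
  have hii : ∀ {w : ℝ → E₁ × E₂}, BackwardBounded μ w →
      IntegrableOn (fun s => exp ((t - s) • N.B) (N.G s (w s))) (Iic t) := fun hw =>
    integrableOn_exp_smul_of_weighted (continuousOn_G hw.1)
      (integrableOn_exp_mul_norm_G hβ hF hw) ht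
  have hij : ∀ {w : ℝ → E₁ × E₂}, BackwardBounded μ w →
      IntervalIntegrable (fun s => exp ((t - s) • N.A) (N.F s (w s))) volume 0 t := fun hw =>
    ((continuousOn_exp_smul_apply (continuous_sub_left t) (continuousOn_F hw.1)).mono
      (by rw [uIcc_of_ge ht]; exact Icc_subset_Iic_self)).intervalIntegrable
  have h1 : (N.perron x₀ u t - N.perron x₀ v t).1 =
      ∫ s in (0 : ℝ)..t, exp ((t - s) • N.A) (N.F s (u s) - N.F s (v s)) := by
    simp only [map_sub]
    rw [intervalIntegral.integral_sub (hij hu) (hij hv)]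
    simp [perron]
  have h2 : (N.perron x₀ u t - N.perron x₀ v t).2 =
      ∫ s in Iic t, exp ((t - s) • N.B) (N.G s (u s) - N.G s (v s)) := by
    simp only [map_sub]
    rw [integral_sub (hii hu) (hii hv)]
    simp [perron]
  have b1 := norm_slow_integral_le (N := N) (p := fun s => N.F s (u s) - N.F s (v s))
    (D := N.L₁ * C) hα ht fun s hs => by
      refine (N.F_lipschitz s _ _).trans ?_
      rw [mul_assoc]
      exact mul_le_mul_of_nonneg_left (hC s hs) N.L₁_nonneg
  have b2 := norm_fast_integral_le (N := N) (p := fun s => N.G s (u s) - N.G s (v s))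
    (D := N.L₂ * C) hβ ht fun s hs => by
      refine (N.G_lipschitz s _ _).trans ?_
      rw [mul_assoc]
      exact mul_le_mul_of_nonneg_left (hC s hs) N.L₂_nonneg
  rw [l1Norm, h1, h2]
  refine (add_le_add b1 b2).trans_eq ?_
  ring

/-- The Lyapunov-Perron map has a fixed point in `C_μ⁻`, the pointwise limit of the Picard
iterates. -/
theorem exists_isPerronOrbit (hgap : N.HasGap μ) (hF : N.ForcingIntegrable μ) (x₀ : E₁) :
    ∃ u, N.IsPerronOrbit μ x₀ u ∧
      ∀ t ≤ 0, Tendsto (fun k => ((N.perron x₀)^[k] fun _ => 0) t) atTop (𝓝 (u t)) := by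
  have hα := sub_pos.2 hgap.2.1
  have hβ := sub_pos.2 hgap.1
  have h := exists_fixedPoint_of_weighted_contraction (I := Iic 0)
    (W := fun t => Real.exp (μ * t)) (N := l1Norm) (c := 2) (by fun_prop)
    (fun t _ => Real.exp_nonneg _) norm_le_l1Norm l1Norm_le_two_mul_norm
    (q := N.L₁ / (N.α - μ) + N.L₂ / (μ - N.β))
    (add_nonneg (div_nonneg N.L₁_nonneg hα.le) (div_nonneg N.L₂_nonneg hβ.le)) hgap.2.2
    (N.perron x₀) (fun _ => 0) continuousOn_const
    (fun u hu t ht => (hasDerivWithinAt_perron hgap.1 hF (inWeightedClass_zero_iff.1 hu) x₀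
      ht).continuousWithinAt)
    (by simpa using l1Norm_perron_zero_le hgap hF x₀)
    (fun u v hu hv C hC t ht => l1Norm_perron_sub_le hgap hF x₀
      (inWeightedClass_zero_iff.1 hu) (inWeightedClass_zero_iff.1 hv) hC ht)
  obtain ⟨u, hu, hfix, hlim⟩ := h
  exact ⟨u, ⟨inWeightedClass_zero_iff.1 hu, hfix⟩, hlim⟩

theorem IsPerronOrbit.unique (hgap : N.HasGap μ) (hF : N.ForcingIntegrable μ) {x₀ : E₁}
    {u v : ℝ → E₁ × E₂} (hu : N.IsPerronOrbit μ x₀ u) (hv : N.IsPerronOrbit μ x₀ v) :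
    EqOn u v (Iic 0) := by
  have hα := sub_pos.2 hgap.2.1
  have hβ := sub_pos.2 hgap.1
  refine eqOn_of_weighted_contraction (N := l1Norm) (W := fun t => Real.exp (μ * t))
    norm_le_l1Norm (add_nonneg (div_nonneg N.L₁_nonneg hα.le) (div_nonneg N.L₂_nonneg hβ.le))
    hgap.2.2 (fun C hC t ht => ?_) (hu.1.exists_sub_le hv.1)
  rw [hu.2 t ht, hv.2 t ht]
  exact l1Norm_perron_sub_le hgap hF x₀ hu.1 hv.1 hC ht

/-- Fixed points of the Lyapunov-Perron map are the solutions on `(-∞, 0]` which lie in `C_μ⁻`. -/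
theorem isPerronOrbit_iff (hβ : N.β < μ) (hF : N.ForcingIntegrable μ) {x₀ : E₁}
    {u : ℝ → E₁ × E₂} : N.IsPerronOrbit μ x₀ u ↔
      BackwardBounded μ u ∧ N.IsSolutionOn (Iic 0) u ∧ (u 0).1 = x₀ := by
  constructor
  · rintro ⟨hu, hfix⟩
    refine ⟨hu, fun t ht => ?_, ?_⟩
    · have h := hasDerivWithinAt_perron hβ hF hu x₀ ht
      rw [← hfix t ht] at h
      exact h.congr hfix (hfix t ht)
    · rw [hfix 0 le_rfl]
      simp [perron, -zero_smul, exp_zero_smul_apply]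
  · rintro ⟨hu, hsol, h0⟩
    have hd1 : ∀ t ≤ 0, HasDerivWithinAt (fun t => (u t).1) (N.A (u t).1 + N.F t (u t)) (Iic 0) t :=
      fun t ht => (hsol t ht).fst
    have hd2 : ∀ t ≤ 0, HasDerivWithinAt (fun t => (u t).2) (N.B (u t).2 + N.G t (u t)) (Iic 0) t :=
      fun t ht => (hsol t ht).snd
    refine ⟨hu, fun t ht => Prod.ext ?_ ?_⟩
    · have h := variation_of_constants N.A ht ((continuousOn_F hu.1).mono Icc_subset_Iic_self)
        (fun s hs => (hd1 s hs.2).mono Icc_subset_Iic_self) t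
      rw [sub_self, exp_zero_smul_apply, sub_zero, h0] at h
      simp only [perron]
      rw [intervalIntegral.integral_symm, h]
      abel
    · -- let the initial time tend to `-∞` in the variation of constants formula
      have hi := integrableOn_exp_smul_of_weighted (continuousOn_G hu.1)
        (integrableOn_exp_mul_norm_G hβ hF hu) ht
      have hlim := intervalIntegral_tendsto_integral_Iic t hi tendsto_id
      obtain ⟨huc, C, hC⟩ := hu
      have hlim0 : Tendsto (fun r => exp ((t - r) • N.B) (u r).2) atBot (𝓝 0) := by
        have hexp : Tendsto (fun r => C * Real.exp (N.β * t) * Real.exp ((μ - N.β) * r)) atBot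
            (𝓝 0) := by
          have := (Real.tendsto_exp_atBot.comp
            (tendsto_id.const_mul_atBot (sub_pos.2 hβ))).const_mul (C * Real.exp (N.β * t))
          simpa using this
        refine squeeze_zero_norm' ?_ hexp
        filter_upwards [eventually_le_atBot t] with r hr
        refine (N.exp_B_le (t - r) (sub_nonneg.2 hr) _).trans ?_
        have h1 : ‖(u r).2‖ ≤ C * Real.exp (μ * r) :=
          (le_add_of_nonneg_left (norm_nonneg _)).trans (hC r (hr.trans ht))
        refine (mul_le_mul_of_nonneg_left h1 (Real.exp_nonneg _)).trans_eq ?_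
        rw [mul_left_comm, mul_assoc, ← Real.exp_add, ← Real.exp_add]
        ring_nf
      have hvoc : ∀ᶠ r in atBot, (∫ s in r..t, exp ((t - s) • N.B) (N.G s (u s))) =
          (u t).2 - exp ((t - r) • N.B) (u r).2 := by
        filter_upwards [eventually_le_atBot t] with r hr
        have hsub : Icc r t ⊆ Iic 0 := fun s hs => hs.2.trans ht
        have h := variation_of_constants N.B hr ((continuousOn_G huc).mono hsub)
          (fun s hs => (hd2 s (hsub hs)).mono hsub) t
        rwa [sub_self, exp_zero_smul_apply] at h
      have := (tendsto_const_nhds (x := (u t).2)).sub hlim0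
      rw [sub_zero] at this
      exact tendsto_nhds_unique (this.congr' (hvoc.mono fun _ h => h.symm)) hlim

end SplitSystem

/-! ### The invariant manifold of a split system -/

namespace SplitSystem

open NormedSpace Filter Topology NNReal

section Flow

variable {E₁ E₂ : Type*} [NormedAddCommGroup E₁] [NormedSpace ℝ E₁]
  [NormedAddCommGroup E₂] [NormedSpace ℝ E₂] {N : SplitSystem E₁ E₂} {μ : ℝ}

theorem continuous_vectorField : Continuous (Function.uncurry N.vectorField) :=
  ((N.A.continuous.comp (continuous_fst.comp continuous_snd)).add N.continuous_F).prodMk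
    ((N.B.continuous.comp (continuous_snd.comp continuous_snd)).add N.continuous_G)

theorem exists_lipschitzWith_vectorField (N : SplitSystem E₁ E₂) :
    ∃ K : ℝ≥0, ∀ t, LipschitzWith K (N.vectorField t) := by
  have h0 : 0 ≤ ‖N.A‖ + ‖N.B‖ + 2 * N.L₁ + 2 * N.L₂ := by
    have := N.L₁_nonneg; have := N.L₂_nonneg; positivity
  refine ⟨⟨_, h0⟩, fun t => LipschitzWith.of_dist_le_mul fun z z' => ?_⟩
  rw [dist_eq_norm, dist_eq_norm]
  change _ ≤ (‖N.A‖ + ‖N.B‖ + 2 * N.L₁ + 2 * N.L₂) * ‖z - z'‖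
  have hz := l1Norm_le_two_mul_norm (z - z')
  have hF := (N.F_lipschitz t z z').trans (mul_le_mul_of_nonneg_left hz N.L₁_nonneg)
  have hG := (N.G_lipschitz t z z').trans (mul_le_mul_of_nonneg_left hz N.L₂_nonneg)
  have hA : ‖N.A (z.1 - z'.1)‖ ≤ ‖N.A‖ * ‖z - z'‖ :=
    (N.A.le_opNorm _).trans (by gcongr; exact norm_fst_le (z - z'))
  have hB : ‖N.B (z.2 - z'.2)‖ ≤ ‖N.B‖ * ‖z - z'‖ :=
    (N.B.le_opNorm _).trans (by gcongr; exact norm_snd_le (z - z'))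
  have e1 : (N.vectorField t z - N.vectorField t z').1 =
      N.A (z.1 - z'.1) + (N.F t z - N.F t z') := by simp [vectorField]; abel
  have e2 : (N.vectorField t z - N.vectorField t z').2 =
      N.B (z.2 - z'.2) + (N.G t z - N.G t z') := by simp [vectorField]; abel
  have n1 := norm_add_le (N.A (z.1 - z'.1)) (N.F t z - N.F t z')
  have n2 := norm_add_le (N.B (z.2 - z'.2)) (N.G t z - N.G t z')
  have p1 := mul_nonneg (norm_nonneg N.A) (norm_nonneg (z - z'))
  have p2 := mul_nonneg (norm_nonneg N.B) (norm_nonneg (z - z'))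
  have p3 := mul_nonneg N.L₁_nonneg (norm_nonneg (z - z'))
  have p4 := mul_nonneg N.L₂_nonneg (norm_nonneg (z - z'))
  refine max_le ?_ ?_
  · rw [e1]; linarith
  · rw [e2]; linarith

theorem IsSolutionOn.mono {I J : Set ℝ} {Z : ℝ → E₁ × E₂} (h : N.IsSolutionOn I Z) (hJ : J ⊆ I) :
    N.IsSolutionOn J Z := fun t ht => (h t (hJ ht)).mono hJ

theorem IsSolutionOn.continuousOn {I : Set ℝ} {Z : ℝ → E₁ × E₂} (h : N.IsSolutionOn I Z) :
    ContinuousOn Z I := fun t ht => (h t ht).continuousWithinAt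

theorem IsSolutionOn.shift {I J : Set ℝ} {Z : ℝ → E₁ × E₂} (h : N.IsSolutionOn I Z) {τ : ℝ}
    (hJ : MapsTo (· + τ) J I) : (N.shift τ).IsSolutionOn J fun s => Z (s + τ) := by
  intro t ht
  have := (h (t + τ) (hJ ht)).scomp t ((hasDerivWithinAt_id t J).add_const τ) hJ
  rw [one_smul] at this
  exact this

theorem IsSolutionOn.of_shift {I J : Set ℝ} {Z : ℝ → E₁ × E₂} {τ : ℝ}
    (h : (N.shift τ).IsSolutionOn I Z) (hJ : MapsTo (· - τ) J I) :
    N.IsSolutionOn J fun s => Z (s - τ) := by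
  intro t ht
  have := (h (t - τ) (hJ ht)).scomp t ((hasDerivWithinAt_id t J).sub_const τ) hJ
  have hV : ∀ z, (N.shift τ).vectorField (t - τ) z = N.vectorField t z := fun z => by
    simp only [vectorField, SplitSystem.shift, sub_add_cancel]
  rw [one_smul, hV] at this
  exact this

theorem IsSolutionOn.eqOn_Icc {a b : ℝ} {Z Z' : ℝ → E₁ × E₂} (h : N.IsSolutionOn (Icc a b) Z)
    (h' : N.IsSolutionOn (Icc a b) Z') (h0 : Z a = Z' a) : EqOn Z Z' (Icc a b) := by
  obtain ⟨K, hK⟩ := N.exists_lipschitzWith_vectorField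
  have hd : ∀ {Z}, N.IsSolutionOn (Icc a b) Z → ∀ t ∈ Ico a b,
      HasDerivWithinAt Z (N.vectorField t (Z t)) (Ici t) t := fun h t ht =>
    (h t (Ico_subset_Icc_self ht)).mono_of_mem_nhdsWithin (Icc_mem_nhdsGE_of_mem ht)
  intro t ht
  have := dist_le_of_trajectories_ODE (δ := 0) hK h.continuousOn (hd h) h'.continuousOn (hd h')
    (by simp [h0]) t ht
  simpa using this

/-- A backward and a forward solution with the same value at `0` join to a solution on `ℝ`. -/
theorem IsSolutionOn.join {u Z : ℝ → E₁ × E₂} (hu : N.IsSolutionOn (Iic 0) u)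
    (hZ : N.IsSolutionOn (Ici 0) Z) (h0 : u 0 = Z 0) :
    N.IsSolutionOn univ fun t => if t ≤ 0 then u t else Z t := by
  set U : ℝ → E₁ × E₂ := fun t => if t ≤ 0 then u t else Z t with hU
  have hUu : ∀ t ∈ Iic (0 : ℝ), U t = u t := fun t ht => if_pos ht
  have hUZ : ∀ t ∈ Ici (0 : ℝ), U t = Z t := fun t ht => by
    rcases (mem_Ici.1 ht).eq_or_lt with h | h
    · subst h; simp [hU, h0]
    · exact if_neg (not_le.2 h)
  have d1 : ∀ t ∈ Iic (0 : ℝ), HasDerivWithinAt U (N.vectorField t (U t)) (Iic 0) t :=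
    fun t ht => by
    rw [hUu t ht]; exact (hu t ht).congr hUu (hUu t ht)
  have d2 : ∀ t ∈ Ici (0 : ℝ), HasDerivWithinAt U (N.vectorField t (U t)) (Ici 0) t :=
    fun t ht => by
    rw [hUZ t ht]; exact (hZ t ht).congr hUZ (hUZ t ht)
  intro t _
  rcases lt_trichotomy t 0 with h | h | h
  · exact ((d1 t h.le).hasDerivAt (Iic_mem_nhds h)).hasDerivWithinAt
  · subst h
    have := (d1 0 self_mem_Iic).union (d2 0 self_mem_Ici)
    rwa [Iic_union_Ici] at this
  · exact ((d2 t h.le).hasDerivAt (Ici_mem_nhds h)).hasDerivWithinAt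

variable (N μ) in
/-- The initial values of the orbits in `C_μ⁻`: the graph over `E₁` whose second coordinate at `x₀`
is that of the fixed point of the Lyapunov-Perron map at time `0`. -/
def manifold : Set (E₁ × E₂) := {z | ∃ u, N.IsPerronOrbit μ z.1 u ∧ u 0 = z}

variable [CompleteSpace E₁] [CompleteSpace E₂]

theorem exists_isSolutionOn_Ici (N : SplitSystem E₁ E₂) (z : E₁ × E₂) :
    ∃ Z, Z 0 = z ∧ N.IsSolutionOn (Ici 0) Z := by
  obtain ⟨K, hK⟩ := N.exists_lipschitzWith_vectorField
  obtain ⟨Z, hZ0, hZ⟩ := exists_forward_solution (V := N.vectorField) continuous_vectorField hK z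
  exact ⟨Z, hZ0, hZ⟩

theorem exists_mem_manifold (hgap : N.HasGap μ) (hF : N.ForcingIntegrable μ) (x : E₁) :
    ∃ y, (x, y) ∈ N.manifold μ := by
  obtain ⟨u, hu, -⟩ := exists_isPerronOrbit hgap hF x
  have h0 := ((isPerronOrbit_iff hgap.1 hF).1 hu).2.2
  exact ⟨(u 0).2, u, hu, Prod.ext h0 rfl⟩

/-- The manifold does not depend on the rate, as long as the gap condition holds: the spaces `C_μ⁻`
are nested. -/
theorem manifold_eq_of_le {ν : ℝ} (hνμ : ν ≤ μ) (hμ : N.HasGap μ) (hν : N.HasGap ν)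
    (hFμ : N.ForcingIntegrable μ) (hFν : N.ForcingIntegrable ν) :
    N.manifold μ = N.manifold ν := by
  refine Subset.antisymm (fun z ⟨u, hu, hu0⟩ => ⟨u, hu.mono hνμ, hu0⟩) fun z ⟨u, hu, hu0⟩ => ?_
  obtain ⟨v, hv, -⟩ := exists_isPerronOrbit hμ hFμ z.1
  exact ⟨v, hv, ((hv.mono hνμ).unique hν hFν hu self_mem_Iic).trans hu0⟩

/-- Positive invariance of the manifold. -/
theorem IsSolutionOn.mem_manifold (hβ : N.β < μ) {τ : ℝ} (hτ : 0 ≤ τ)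
    (hF : N.ForcingIntegrable μ) (hF' : (N.shift τ).ForcingIntegrable μ) {Z : ℝ → E₁ × E₂}
    (hZ : N.IsSolutionOn (Ici 0) Z) (h0 : Z 0 ∈ N.manifold μ) :
    Z τ ∈ (N.shift τ).manifold μ := by
  obtain ⟨u, hu, hu0⟩ := h0
  obtain ⟨hub, husol, -⟩ := (isPerronOrbit_iff hβ hF).1 hu
  have hU := (husol.join hZ hu0).shift (τ := τ) (mapsTo_univ _ univ)
  set w : ℝ → E₁ × E₂ := fun s => if s + τ ≤ 0 then u (s + τ) else Z (s + τ) with hw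
  have hw0 : w 0 = Z τ := by
    rcases hτ.eq_or_lt with h | h
    · subst h; simp [hw, hu0]
    · simp [hw, not_le.2 h]
  have hwsol := hU.mono (subset_univ (Iic 0))
  refine ⟨w, (isPerronOrbit_iff (N := N.shift τ) hβ hF').2 ⟨?_, hwsol, by rw [hw0]⟩, hw0⟩
  obtain ⟨-, C, hC⟩ := hub
  refine BackwardBounded.of_le (τ := -τ) (C := C * Real.exp (μ * τ)) hwsol.continuousOn
    fun t ht => ?_
  have ht' : t + τ ≤ 0 := by linarith
  simp only [hw, ht', if_true]
  refine (hC _ ht').trans_eq ?_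
  rw [mul_assoc, ← Real.exp_add]
  ring_nf

/-- Every point of the manifold at a later time is reached along the manifold. -/
theorem exists_isSolutionOn_of_mem_manifold (hβ : N.β < μ) {τ : ℝ} (hτ : 0 ≤ τ)
    (hF : N.ForcingIntegrable μ) (hF' : (N.shift τ).ForcingIntegrable μ) {z : E₁ × E₂}
    (hz : z ∈ (N.shift τ).manifold μ) :
    ∃ Z, N.IsSolutionOn (Ici 0) Z ∧ Z 0 ∈ N.manifold μ ∧ Z τ = z := by
  obtain ⟨u, hu, hu0⟩ := hz
  obtain ⟨hub, husol, -⟩ := (isPerronOrbit_iff (N := N.shift τ) hβ hF').1 hu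
  have hsol : N.IsSolutionOn (Iic τ) fun s => u (s - τ) :=
    husol.of_shift fun s (hs : s ≤ τ) => sub_nonpos.2 hs
  obtain ⟨Z, hZ0, hZ⟩ := N.exists_isSolutionOn_Ici (u (0 - τ))
  refine ⟨Z, hZ, ?_, ?_⟩
  · refine ⟨fun s => u (s - τ), (isPerronOrbit_iff hβ hF).2 ⟨?_, hsol.mono (Iic_subset_Iic.2 hτ),
      by rw [hZ0]⟩, hZ0.symm⟩
    obtain ⟨-, C, hC⟩ := hub
    refine ⟨(hsol.mono (Iic_subset_Iic.2 hτ)).continuousOn, C * Real.exp (-(μ * τ)),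
      fun t ht => ?_⟩
    refine (hC (t - τ) (by linarith)).trans_eq ?_
    rw [mul_assoc, ← Real.exp_add]
    ring_nf
  · have := (hZ.mono Icc_subset_Ici_self).eqOn_Icc (hsol.mono Icc_subset_Iic_self) hZ0
      ⟨hτ, le_rfl⟩
    rw [this, ← hu0]
    simp

end Flow

/-! ### Cones, squeezing and tracking -/

section Cone

/-- A one-sided Grönwall inequality which allows functions of any sign. -/
theorem le_mul_exp_of_deriv_le {φ φ' : ℝ → ℝ} {a b k : ℝ} (hab : a ≤ b)
    (h : ∀ t ∈ Icc a b, HasDerivWithinAt φ (φ' t) (Icc a b) t)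
    (hle : ∀ t ∈ Icc a b, φ' t ≤ k * φ t) : φ b ≤ φ a * Real.exp (k * (b - a)) := by
  have hd : ∀ t ∈ Icc a b, HasDerivWithinAt (fun t => φ t * Real.exp (-(k * t)))
      ((φ' t - k * φ t) * Real.exp (-(k * t))) (Icc a b) t := by
    intro t ht
    have h1 : HasDerivAt (fun t => Real.exp (-(k * t))) (Real.exp (-(k * t)) * -(k * 1)) t :=
      (((hasDerivAt_id t).const_mul k).neg).exp
    refine ((h t ht).mul h1.hasDerivWithinAt).congr_deriv ?_
    ring
  have hanti : AntitoneOn (fun t => φ t * Real.exp (-(k * t))) (Icc a b) := by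
    refine antitoneOn_of_hasDerivWithinAt_nonpos (convex_Icc a b)
      (fun t ht => (hd t ht).continuousWithinAt)
      (fun t ht => (hd t (interior_subset ht)).mono interior_subset) fun t ht => ?_
    exact mul_nonpos_of_nonpos_of_nonneg (sub_nonpos.2 (hle t (interior_subset ht)))
      (Real.exp_nonneg _)
  have := hanti (left_mem_Icc.2 hab) (right_mem_Icc.2 hab) hab
  have h2 := mul_le_mul_of_nonneg_right this (Real.exp_nonneg (k * b))
  simp only [mul_assoc, ← Real.exp_add] at h2
  have e1 : -(k * b) + k * b = 0 := by ring
  have e2 : -(k * a) + k * b = k * (b - a) := by ring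
  rwa [e1, e2, Real.exp_zero, mul_one] at h2

variable {E₁ E₂ : Type*} [NormedAddCommGroup E₁] [InnerProductSpace ℝ E₁]
  [NormedAddCommGroup E₂] [InnerProductSpace ℝ E₂]
  {N : SplitSystem E₁ E₂} {μ δ : ℝ} {Z Z' : ℝ → E₁ × E₂} {a b : ℝ}

variable (N) in
/-- The growth rate outside the cone `‖y‖ ≤ δ ‖x‖`. -/
noncomputable def rate (δ : ℝ) : ℝ := N.β + N.L₂ + δ⁻¹ * N.L₂

variable (N) in
/-- The condition for the cone `‖y‖ ≤ δ ‖x‖` to be positively invariant for the differences of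
solutions: the growth rate outside does not exceed the one inside. -/
def ConeCondition (δ : ℝ) : Prop := 0 < δ ∧ N.rate δ ≤ N.α - N.L₁ - δ * N.L₁

theorem hasDerivWithinAt_norm_sq_sub {I : Set ℝ} (hZ : N.IsSolutionOn I Z)
    (hZ' : N.IsSolutionOn I Z') {t : ℝ} (ht : t ∈ I) :
    HasDerivWithinAt (fun t => ‖(Z t).1 - (Z' t).1‖ ^ 2)
      (2 * inner ℝ ((Z t).1 - (Z' t).1)
        (N.A ((Z t).1 - (Z' t).1) + (N.F t (Z t) - N.F t (Z' t)))) I t ∧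
    HasDerivWithinAt (fun t => ‖(Z t).2 - (Z' t).2‖ ^ 2)
      (2 * inner ℝ ((Z t).2 - (Z' t).2)
        (N.B ((Z t).2 - (Z' t).2) + (N.G t (Z t) - N.G t (Z' t)))) I t := by
  constructor
  · have h1 : HasDerivWithinAt (fun t => (Z t).1) (N.vectorField t (Z t)).1 I t := (hZ t ht).fst
    have h2 : HasDerivWithinAt (fun t => (Z' t).1) (N.vectorField t (Z' t)).1 I t :=
      (hZ' t ht).fst
    have h : HasDerivWithinAt (fun t => (Z t).1 - (Z' t).1)
        ((N.vectorField t (Z t)).1 - (N.vectorField t (Z' t)).1) I t := h1.sub h2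
    refine h.norm_sq.congr_deriv ?_
    simp only [vectorField, map_sub]
    congr 2; abel
  · have h1 : HasDerivWithinAt (fun t => (Z t).2) (N.vectorField t (Z t)).2 I t := (hZ t ht).snd
    have h2 : HasDerivWithinAt (fun t => (Z' t).2) (N.vectorField t (Z' t)).2 I t :=
      (hZ' t ht).snd
    have h : HasDerivWithinAt (fun t => (Z t).2 - (Z' t).2)
        ((N.vectorField t (Z t)).2 - (N.vectorField t (Z' t)).2) I t := h1.sub h2
    refine h.norm_sq.congr_deriv ?_
    simp only [vectorField, map_sub]
    congr 2; abel

theorem inner_slow_ge [CompleteSpace E₁] (N : SplitSystem E₁ E₂) (t : ℝ) (z z' : E₁ × E₂) :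
    N.α * ‖z.1 - z'.1‖ ^ 2 - N.L₁ * ‖z.1 - z'.1‖ * (‖z.1 - z'.1‖ + ‖z.2 - z'.2‖) ≤
      inner ℝ (z.1 - z'.1) (N.A (z.1 - z'.1) + (N.F t z - N.F t z')) := by
  have h1 := inner_ge_of_exp_bound N.exp_A_le (z.1 - z'.1)
  have h2 := abs_le.1 (abs_real_inner_le_norm (z.1 - z'.1) (N.F t z - N.F t z'))
  have h3 := mul_le_mul_of_nonneg_left (N.F_lipschitz t z z') (norm_nonneg (z.1 - z'.1))
  simp only [l1Norm, Prod.fst_sub, Prod.snd_sub] at h3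
  rw [inner_add_right]
  linarith [h2.1]

theorem inner_fast_le [CompleteSpace E₂] (N : SplitSystem E₁ E₂) (t : ℝ) (z z' : E₁ × E₂) :
    inner ℝ (z.2 - z'.2) (N.B (z.2 - z'.2) + (N.G t z - N.G t z')) ≤
      N.β * ‖z.2 - z'.2‖ ^ 2 + N.L₂ * ‖z.2 - z'.2‖ * (‖z.1 - z'.1‖ + ‖z.2 - z'.2‖) := by
  have h1 := inner_le_of_exp_bound N.exp_B_le (z.2 - z'.2)
  have h2 := abs_le.1 (abs_real_inner_le_norm (z.2 - z'.2) (N.G t z - N.G t z'))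
  have h3 := mul_le_mul_of_nonneg_left (N.G_lipschitz t z z') (norm_nonneg (z.2 - z'.2))
  simp only [l1Norm, Prod.fst_sub, Prod.snd_sub] at h3
  rw [inner_add_right]
  linarith [h2.2]

theorem fast_sq_le_of_outside_cone [CompleteSpace E₂] (hδ0 : 0 < δ) (hab : a ≤ b)
    (hZ : N.IsSolutionOn (Icc a b) Z) (hZ' : N.IsSolutionOn (Icc a b) Z')
    (hout : ∀ t ∈ Icc a b, δ * ‖(Z t).1 - (Z' t).1‖ ≤ ‖(Z t).2 - (Z' t).2‖) :
    ‖(Z b).2 - (Z' b).2‖ ^ 2 ≤ ‖(Z a).2 - (Z' a).2‖ ^ 2 * Real.exp (2 * N.rate δ * (b - a)) := by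
  refine le_mul_exp_of_deriv_le (φ := fun t => ‖(Z t).2 - (Z' t).2‖ ^ 2) hab
    (fun t ht => (hasDerivWithinAt_norm_sq_sub hZ hZ' ht).2) fun t ht => ?_
  have h2 := inner_fast_le N t (Z t) (Z' t)
  have h3 := hout t ht
  set x := ‖(Z t).1 - (Z' t).1‖
  set r := ‖(Z t).2 - (Z' t).2‖ with hr
  have hr0 : 0 ≤ r := norm_nonneg _
  have hx : x ≤ δ⁻¹ * r := by rwa [le_inv_mul_iff₀ hδ0]
  have h4 := mul_le_mul_of_nonneg_left hx (mul_nonneg N.L₂_nonneg hr0)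
  simp only [rate]
  nlinarith

variable [CompleteSpace E₁] [CompleteSpace E₂]

/-- The indefinite quadratic form which defines the cone satisfies a linear differential
inequality along differences of solutions, whatever its sign. -/
theorem cone_form_le (hδ : N.ConeCondition δ) (hab : a ≤ b) (hZ : N.IsSolutionOn (Icc a b) Z)
    (hZ' : N.IsSolutionOn (Icc a b) Z') :
    ∃ c > 0, ‖(Z b).2 - (Z' b).2‖ ^ 2 - δ ^ 2 * ‖(Z b).1 - (Z' b).1‖ ^ 2 ≤
      (‖(Z a).2 - (Z' a).2‖ ^ 2 - δ ^ 2 * ‖(Z a).1 - (Z' a).1‖ ^ 2) * c := by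
  obtain ⟨hδ0, hcone⟩ := hδ
  set ρ : ℝ := N.β + N.L₂ + (δ⁻¹ * N.L₂ + δ * N.L₁) / 2 with hρ
  refine ⟨Real.exp (2 * ρ * (b - a)), Real.exp_pos _, le_mul_exp_of_deriv_le
    (φ := fun t => ‖(Z t).2 - (Z' t).2‖ ^ 2 - δ ^ 2 * ‖(Z t).1 - (Z' t).1‖ ^ 2) hab
    (fun t ht => (hasDerivWithinAt_norm_sq_sub hZ hZ' ht).2.sub
      ((hasDerivWithinAt_norm_sq_sub hZ hZ' ht).1.const_mul (δ ^ 2))) fun t ht => ?_⟩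
  have h1 := inner_slow_ge N t (Z t) (Z' t)
  have h2 := inner_fast_le N t (Z t) (Z' t)
  set x := ‖(Z t).1 - (Z' t).1‖
  set r := ‖(Z t).2 - (Z' t).2‖
  -- mixed terms, by Young's inequality for `r` and `δ x`
  have hy : r * (δ * x) ≤ (r ^ 2 + (δ * x) ^ 2) / 2 := by nlinarith [sq_nonneg (r - δ * x)]
  have m1 : N.L₂ * r * x ≤ δ⁻¹ * N.L₂ * ((r ^ 2 + (δ * x) ^ 2) / 2) := by
    have : N.L₂ * r * x = δ⁻¹ * N.L₂ * (r * (δ * x)) := by field_simp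
    rw [this]
    exact mul_le_mul_of_nonneg_left hy (mul_nonneg (inv_nonneg.2 hδ0.le) N.L₂_nonneg)
  have m2 : δ ^ 2 * (N.L₁ * x * r) ≤ δ * N.L₁ * ((r ^ 2 + (δ * x) ^ 2) / 2) := by
    have : δ ^ 2 * (N.L₁ * x * r) = δ * N.L₁ * (r * (δ * x)) := by ring
    rw [this]
    exact mul_le_mul_of_nonneg_left hy (mul_nonneg hδ0.le N.L₁_nonneg)
  have h1' := mul_le_mul_of_nonneg_left h1 (sq_nonneg δ)
  have h3 : ρ * (δ * x) ^ 2 ≤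
      (N.α - N.L₁ - (δ⁻¹ * N.L₂ + δ * N.L₁) / 2) * (δ * x) ^ 2 := by
    refine mul_le_mul_of_nonneg_right ?_ (sq_nonneg _)
    simp only [rate] at hcone
    linarith
  simp only [hρ] at h3 ⊢
  nlinarith

theorem outside_cone_of_outside_cone_right (hδ : N.ConeCondition δ)
    (hZ : N.IsSolutionOn (Icc a b) Z) (hZ' : N.IsSolutionOn (Icc a b) Z')
    (hb : δ * ‖(Z b).1 - (Z' b).1‖ ≤ ‖(Z b).2 - (Z' b).2‖) {t : ℝ} (ht : t ∈ Icc a b) :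
    δ * ‖(Z t).1 - (Z' t).1‖ ≤ ‖(Z t).2 - (Z' t).2‖ := by
  have hsub : Icc t b ⊆ Icc a b := Icc_subset_Icc_left ht.1
  obtain ⟨c, hc, h⟩ := cone_form_le hδ ht.2 (hZ.mono hsub) (hZ'.mono hsub)
  have h1 : 0 ≤ ‖(Z b).2 - (Z' b).2‖ ^ 2 - δ ^ 2 * ‖(Z b).1 - (Z' b).1‖ ^ 2 := by
    rw [← mul_pow, sub_nonneg]
    exact pow_le_pow_left₀ (mul_nonneg hδ.1.le (norm_nonneg _)) hb 2
  have h2 := nonneg_of_mul_nonneg_left (h1.trans h) hc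
  rw [← mul_pow, sub_nonneg] at h2
  exact le_of_sq_le_sq h2 (norm_nonneg _)

/-- The manifold is a Lipschitz graph: a difference of two orbits in `C_μ⁻` which leaves the cone
at time `0` would have been outside the cone in the whole past, and then would grow backwards in
time faster than `C_μ⁻` allows. -/
theorem norm_snd_sub_le_of_mem_manifold (hδ : N.ConeCondition δ) (hμ : N.rate δ < μ)
    (hβ : N.β < μ) (hF : N.ForcingIntegrable μ) {z z' : E₁ × E₂} (hz : z ∈ N.manifold μ)
    (hz' : z' ∈ N.manifold μ) : ‖z.2 - z'.2‖ ≤ δ * ‖z.1 - z'.1‖ := by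
  obtain ⟨u, hu, hu0⟩ := hz
  obtain ⟨v, hv, hv0⟩ := hz'
  obtain ⟨hub, husol, -⟩ := (isPerronOrbit_iff hβ hF).1 hu
  obtain ⟨hvb, hvsol, -⟩ := (isPerronOrbit_iff hβ hF).1 hv
  obtain ⟨C, hC⟩ := hub.exists_sub_le hvb
  rw [← hu0, ← hv0]
  by_contra! hlt
  have hout : ∀ t ≤ 0, δ * ‖(u t).1 - (v t).1‖ ≤ ‖(u t).2 - (v t).2‖ := fun t ht =>
    outside_cone_of_outside_cone_right hδ (husol.mono Icc_subset_Iic_self)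
      (hvsol.mono Icc_subset_Iic_self) hlt.le (left_mem_Icc.2 ht)
  have hbound : ∀ t ≤ 0, ‖(u 0).2 - (v 0).2‖ ^ 2 ≤
      C ^ 2 * Real.exp (2 * (μ - N.rate δ) * t) := by
    intro t ht
    refine (fast_sq_le_of_outside_cone hδ.1 ht (husol.mono Icc_subset_Iic_self)
      (hvsol.mono Icc_subset_Iic_self) fun s hs => hout s hs.2).trans ?_
    have h1 : ‖(u t).2 - (v t).2‖ ≤ C * Real.exp (μ * t) :=
      (le_add_of_nonneg_left (norm_nonneg _)).trans (hC t ht)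
    calc _ ≤ (C * Real.exp (μ * t)) ^ 2 * Real.exp (2 * N.rate δ * (0 - t)) := by gcongr
      _ = _ := by
        rw [mul_pow, ← Real.exp_nat_mul, mul_assoc, ← Real.exp_add]
        push_cast
        ring_nf
  have hlim : Tendsto (fun t => C ^ 2 * Real.exp (2 * (μ - N.rate δ) * t)) atBot (𝓝 0) := by
    have := (Real.tendsto_exp_atBot.comp (tendsto_id.const_mul_atBot
      (by linarith : 0 < 2 * (μ - N.rate δ)))).const_mul (C ^ 2)
    simpa using this
  have h0 : ‖(u 0).2 - (v 0).2‖ ^ 2 ≤ 0 :=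
    ge_of_tendsto hlim ((eventually_le_atBot 0).mono hbound)
  have h1 : ‖(u 0).2 - (v 0).2‖ = 0 := by
    have := norm_nonneg ((u 0).2 - (v 0).2)
    nlinarith
  rw [h1] at hlt
  exact absurd hlt (not_lt.2 (mul_nonneg hδ.1.le (norm_nonneg _)))

/-- Every forward solution is tracked by one on the manifold. The tracking solution is a limit of
solutions `Zₖ` on the manifold with the same slow component as `Z` at time `k`: their difference
from `Z` stays outside the cone of aperture `δ` up to time `k`, while the manifold is a graph with
the smaller Lipschitz constant `δ'`, so that the initial values of `Zₖ` are bounded. -/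
theorem exists_tracking_solution [FiniteDimensional ℝ E₁] {δ' : ℝ} (hδ : N.ConeCondition δ)
    (hδ' : N.ConeCondition δ') (hlt : δ' < δ) (hμ : N.rate δ' < μ) (hgap : N.HasGap μ)
    (hF : N.ForcingIntegrable μ) (hFτ : ∀ τ, 0 ≤ τ → (N.shift τ).ForcingIntegrable μ)
    (hZ : N.IsSolutionOn (Ici 0) Z) :
    ∃ Z', N.IsSolutionOn (Ici 0) Z' ∧ Z' 0 ∈ N.manifold μ ∧ ∀ t, 0 ≤ t →
      δ * ‖(Z t).1 - (Z' t).1‖ ≤ ‖(Z t).2 - (Z' t).2‖ ∧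
      ‖(Z t).2 - (Z' t).2‖ ≤ ‖(Z 0).2 - (Z' 0).2‖ * Real.exp (N.rate δ * t) := by
  have hlip : ∀ {z z' : E₁ × E₂}, z ∈ N.manifold μ → z' ∈ N.manifold μ →
      ‖z.2 - z'.2‖ ≤ δ' * ‖z.1 - z'.1‖ := fun hz hz' =>
    norm_snd_sub_le_of_mem_manifold hδ' hμ hgap.1 hF hz hz'
  have hk : ∀ k : ℕ, ∃ W, N.IsSolutionOn (Ici 0) W ∧ W 0 ∈ N.manifold μ ∧
      (W k).1 = (Z k).1 := by
    intro k
    obtain ⟨y, hy⟩ := exists_mem_manifold (N := N.shift k) hgap (hFτ k k.cast_nonneg) (Z k).1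
    obtain ⟨W, hW, hW0, hWk⟩ := exists_isSolutionOn_of_mem_manifold hgap.1 k.cast_nonneg hF
      (hFτ k k.cast_nonneg) hy
    exact ⟨W, hW, hW0, by rw [hWk]⟩
  choose W hW hW0 hWk using hk
  have hout : ∀ (k : ℕ) (t : ℝ), 0 ≤ t → t ≤ k →
      δ * ‖(Z t).1 - (W k t).1‖ ≤ ‖(Z t).2 - (W k t).2‖ := fun k t h0 h1 =>
    outside_cone_of_outside_cone_right hδ (hZ.mono Icc_subset_Ici_self)
      ((hW k).mono Icc_subset_Ici_self) (by simp [hWk]) ⟨h0, h1⟩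
  have hdec : ∀ (k : ℕ) (t : ℝ), 0 ≤ t → t ≤ k →
      ‖(Z t).2 - (W k t).2‖ ≤ ‖(Z 0).2 - (W k 0).2‖ * Real.exp (N.rate δ * t) := by
    intro k t h0 h1
    have h := fast_sq_le_of_outside_cone hδ.1 h0 (hZ.mono Icc_subset_Ici_self)
      ((hW k).mono Icc_subset_Ici_self) fun s hs => hout k s hs.1 (hs.2.trans h1)
    refine le_of_sq_le_sq (h.trans_eq ?_) (by positivity)
    rw [mul_pow, ← Real.exp_nat_mul]
    push_cast
    ring_nf
  -- boundedness of the initial values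
  obtain ⟨y₀, hy₀⟩ := exists_mem_manifold hgap hF (Z 0).1
  set R : ℝ := ‖(Z 0).2 - y₀‖ / (δ - δ') with hR
  have hball : ∀ k, (W k 0).1 ∈ Metric.closedBall (Z 0).1 R := by
    intro k
    have h1 := hout k 0 le_rfl k.cast_nonneg
    have h2 := hlip hy₀ (hW0 k)
    have h3 := norm_sub_le_norm_sub_add_norm_sub (Z 0).2 y₀ (W k 0).2
    rw [Metric.mem_closedBall, dist_comm, dist_eq_norm, hR, le_div_iff₀ (sub_pos.2 hlt)]
    simp only at h2
    linarith
  have : ProperSpace E₁ := FiniteDimensional.proper ℝ E₁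
  obtain ⟨x', -, ψ, hψ, hlim⟩ := (isCompact_closedBall (Z 0).1 R).tendsto_subseq hball
  obtain ⟨y', hy'⟩ := exists_mem_manifold hgap hF x'
  obtain ⟨Z', hZ'0, hZ'⟩ := N.exists_isSolutionOn_Ici (x', y')
  have hlim2 : Tendsto (fun k => (W (ψ k) 0).2) atTop (𝓝 y') := by
    rw [tendsto_iff_norm_sub_tendsto_zero] at hlim ⊢
    refine squeeze_zero (fun _ => norm_nonneg _) (fun k => hlip (hW0 (ψ k)) hy') ?_
    simpa using hlim.const_mul δ'
  have hlim0 : Tendsto (fun k => W (ψ k) 0) atTop (𝓝 (Z' 0)) := by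
    rw [hZ'0]
    exact hlim.prodMk_nhds hlim2
  obtain ⟨K, hK⟩ := N.exists_lipschitzWith_vectorField
  have hlimt : ∀ t, 0 ≤ t → Tendsto (fun k => W (ψ k) t) atTop (𝓝 (Z' t)) := by
    intro t ht
    rw [tendsto_iff_dist_tendsto_zero] at hlim0 ⊢
    refine squeeze_zero (fun _ => dist_nonneg)
      (fun k => dist_forward_solution_le hK (hW (ψ k)) hZ' ht) ?_
    simpa using hlim0.mul_const (Real.exp (K * t))
  refine ⟨Z', hZ', hZ'0 ▸ hy', fun t ht => ?_⟩
  have hev : ∀ᶠ k in atTop, t ≤ (ψ k : ℕ) := by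
    filter_upwards [(tendsto_natCast_atTop_atTop.comp hψ.tendsto_atTop).eventually_ge_atTop t]
      with k hk using hk
  have c1 := (tendsto_const_nhds (x := (Z t).1)).sub (hlimt t ht).fst_nhds |>.norm
  have c2 := (tendsto_const_nhds (x := (Z t).2)).sub (hlimt t ht).snd_nhds |>.norm
  have c3 := (tendsto_const_nhds (x := (Z 0).2)).sub hlim0.snd_nhds |>.norm
  exact ⟨le_of_tendsto_of_tendsto (c1.const_mul δ) c2 (hev.mono fun k hk => hout _ t ht hk),
    le_of_tendsto_of_tendsto c2 (c3.mul_const _) (hev.mono fun k hk => hdec _ t ht hk)⟩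

end Cone

end SplitSystem

/-! ### Paths of subexponential mean growth -/

section Growth

open Filter Topology

variable {E : Type*} [NormedAddCommGroup E]

/-- The past of `w` is integrable against every exponential weight. This integrated form of
subexponential growth is all that is used of the Wiener paths. -/
def SubexpGrowth (w : ℝ → E) : Prop :=
  ∀ c : ℝ, 0 < c → IntegrableOn (fun s => Real.exp (c * s) * ‖w s‖) (Iic 0)

theorem continuous_exp_mul_norm {w : ℝ → E} (hw : Continuous w) (c : ℝ) :
    Continuous fun s => Real.exp (c * s) * ‖w s‖ :=
  (by fun_prop : Continuous fun s => Real.exp (c * s)).mul hw.norm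

theorem SubexpGrowth.integrableOn_Iic {w : ℝ → E} (hw : Continuous w) (h : SubexpGrowth w)
    {c : ℝ} (hc : 0 < c) (t : ℝ) :
    IntegrableOn (fun s => Real.exp (c * s) * ‖w s‖) (Iic t) := by
  refine ((h c hc).union (((continuous_exp_mul_norm hw c).continuousOn (s := Icc 0
    t)).integrableOn_compact isCompact_Icc)).mono_set fun s hs => ?_
  rcases le_total s 0 with h | h
  · exact Or.inl h
  · exact Or.inr ⟨h, hs⟩

theorem SubexpGrowth.add {w v : ℝ → E} (hw : Continuous w) (hv : Continuous v)
    (h : SubexpGrowth w) (h' : SubexpGrowth v) : SubexpGrowth fun s => w s + v s := by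
  intro c hc
  refine ((h c hc).add (h' c hc)).mono'
    (continuous_exp_mul_norm (hw.add hv) c).aestronglyMeasurable (ae_of_all _ fun s => ?_)
  rw [Real.norm_of_nonneg (by positivity), Pi.add_apply, ← mul_add]
  gcongr
  exact norm_add_le _ _

theorem subexpGrowth_const (x : E) : SubexpGrowth fun _ => x := fun _ hc =>
  (integrableOn_exp_mul_Iic hc 0).mul_const _

theorem SubexpGrowth.const_smul [NormedSpace ℝ E] {w : ℝ → E} (h : SubexpGrowth w) (k : ℝ) :
    SubexpGrowth fun s => k • w s := by
  intro c hc
  refine ((h c hc).const_mul ‖k‖).congr (ae_of_all _ fun s => ?_)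
  simp only [norm_smul]
  ring

theorem setIntegral_Iic_comp_add [NormedSpace ℝ E] (f : ℝ → E) (t : ℝ) :
    ∫ s in Iic (0 : ℝ), f (s + t) = ∫ s in Iic t, f s := by
  have := (measurePreserving_add_right volume t).setIntegral_preimage_emb
    (measurableEmbedding_addRight t) f (Iic t)
  simpa using this

theorem SubexpGrowth.comp_add {w : ℝ → E} (hw : Continuous w) (h : SubexpGrowth w) (t : ℝ) :
    SubexpGrowth fun s => w (s + t) := by
  intro c hc
  have h1 := (h.integrableOn_Iic hw hc t).const_mul (Real.exp (-(c * t)))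
  have h2 := ((measurePreserving_add_right volume t).integrableOn_comp_preimage
    (measurableEmbedding_addRight t)).2 h1
  have e : (fun x => x + t) ⁻¹' Iic t = Iic 0 := by simp
  rw [e] at h2
  refine h2.congr (ae_of_all _ fun s => ?_)
  simp only [Function.comp_apply]
  rw [← mul_assoc, ← Real.exp_add]
  ring_nf

end Growth

namespace WienerPath

variable {m : ℕ}

theorem shift_apply (t s : ℝ) (w : WienerPath m) : shift t w s = w (s + t) - w t := rfl

theorem shift_shift (s t : ℝ) (w : WienerPath m) : shift s (shift t w) = shift (s + t) w := by
  refine Subtype.ext (funext fun r => ?_)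
  change w (r + s + t) - w t - (w (s + t) - w t) = w (r + (s + t)) - w (s + t)
  rw [add_assoc]
  abel

theorem shift_zero (w : WienerPath m) : shift 0 w = w := by
  refine Subtype.ext (funext fun r => ?_)
  change w (r + 0) - w 0 = w r
  rw [add_zero, w.2.2, sub_zero]

theorem subexpGrowth_shift {w : WienerPath m} (h : SubexpGrowth w.1) (t : ℝ) :
    SubexpGrowth (shift t w).1 := by
  have := (h.comp_add w.2.1 t).add (w.2.1.comp (continuous_id.add continuous_const))
    continuous_const (subexpGrowth_const (-(w t)))
  refine (congrArg SubexpGrowth (funext fun s => ?_)).mp this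
  rw [shift_apply, sub_eq_add_neg]
  rfl

theorem measurable_eval (t : ℝ) : Measurable fun w : WienerPath m => w t :=
  (measurable_pi_apply t).comp (comap_measurable fun w : WienerPath m => w.1)

theorem measurable_uncurry_eval : Measurable fun p : ℝ × WienerPath m => p.2 p.1 :=
  measurable_uncurry_of_continuous_of_measurable (u := fun t (w : WienerPath m) => w t)
    (fun w => w.2.1) measurable_eval

theorem measurable_uncurry_shift : Measurable fun p : ℝ × WienerPath m => shift p.1 p.2 := by
  refine measurable_comap_iff.2 (measurable_pi_iff.2 fun s => ?_)
  exact (measurable_uncurry_eval.comp ((measurable_fst.const_add s).prodMk measurable_snd)).sub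
    measurable_uncurry_eval

end WienerPath

section WienerGrowth

open scoped ENNReal

variable {m : ℕ} {P : Measure (WienerPath m)}

theorem IsWienerMeasure.lintegral_enorm_eval (hP : IsWienerMeasure P) {s : ℝ} (hs : s ≤ 0) :
    ∫⁻ w, ‖w s‖ₑ ∂P = ENNReal.ofReal (Real.sqrt (-s)) * ∫⁻ x, ‖x‖ₑ ∂(stdGaussian (Eucl m)) := by
  have hm : Measurable fun w : WienerPath m => w 0 - w s :=
    (WienerPath.measurable_eval 0).sub (WienerPath.measurable_eval s)
  have h1 : ∫⁻ w, ‖w s‖ₑ ∂P = ∫⁻ x, ‖x‖ₑ ∂(P.map fun w => w 0 - w s) := by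
    refine Eq.trans (lintegral_congr fun w => ?_) (lintegral_map measurable_enorm hm).symm
    rw [w.2.2, zero_sub, enorm_neg]
  rw [h1, hP.map_increment s 0 hs, lintegral_map measurable_enorm (measurable_const_smul _),
    ← lintegral_const_mul _ measurable_enorm, zero_sub]
  refine lintegral_congr fun x => ?_
  rw [enorm_smul, Real.enorm_of_nonneg (Real.sqrt_nonneg _)]

/-- Almost every Wiener path has subexponential mean growth. By Tonelli's theorem it suffices that
`𝔼 |ω(s)| = O(√|s|)`, and no maximal inequality is needed. -/
theorem IsWienerMeasure.ae_subexpGrowth (hP : IsWienerMeasure P) :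
    ∀ᵐ w ∂P, SubexpGrowth w.1 := by
  have := hP.isProbabilityMeasure
  set M : ℝ≥0∞ := ∫⁻ x, ‖x‖ₑ ∂(stdGaussian (Eucl m)) with hM
  have hMfin : M < ∞ := (IsGaussian.integrable_id (μ := stdGaussian (Eucl m))).2
  have key : ∀ k : ℕ, ∀ᵐ w ∂P,
      IntegrableOn (fun s => Real.exp ((1 / ((k : ℝ) + 1)) * s) * ‖w.1 s‖) (Iic 0) := by
    intro k
    set c : ℝ := 1 / ((k : ℝ) + 1) with hc
    have hcpos : 0 < c := by positivity
    set φ : ℝ × WienerPath m → ℝ≥0∞ := fun p => ENNReal.ofReal (Real.exp (c * p.1)) * ‖p.2 p.1‖ₑ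
    have hφ : Measurable φ := by
      refine Measurable.mul ?_ WienerPath.measurable_uncurry_eval.enorm
      fun_prop
    have hfin : ∫⁻ s in Iic (0 : ℝ), ∫⁻ w, φ (s, w) ∂P < ∞ := by
      -- `√|s|` is dominated by an exponential
      have hb : ∀ s ∈ Iic (0 : ℝ), ∫⁻ w, φ (s, w) ∂P ≤
          ENNReal.ofReal ((1 + 2 / c) * Real.exp (c / 2 * s)) * M := by
        intro s hs
        have hs : s ≤ 0 := hs
        simp only [φ]
        rw [lintegral_const_mul _ (WienerPath.measurable_eval s).enorm,
          hP.lintegral_enorm_eval hs, ← mul_assoc, ← ENNReal.ofReal_mul (Real.exp_nonneg _)]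
        refine mul_le_mul_left (ENNReal.ofReal_le_ofReal ?_) M
        have h1 : Real.sqrt (-s) ≤ 1 - s := by
          rw [Real.sqrt_le_left (by linarith)]
          nlinarith
        have h2 : 1 - s ≤ (1 + 2 / c) * Real.exp (-(c / 2 * s)) := by
          have h3 := Real.add_one_le_exp (-(c / 2 * s))
          have h4 : 1 ≤ Real.exp (-(c / 2 * s)) := Real.one_le_exp (by nlinarith)
          have h5 : -s = 2 / c * (-(c / 2 * s)) := by field_simp
          have h6 : 2 / c * (-(c / 2 * s)) ≤ 2 / c * Real.exp (-(c / 2 * s)) := by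
            gcongr
            linarith
          linarith
        calc Real.exp (c * s) * Real.sqrt (-s)
            ≤ Real.exp (c * s) * ((1 + 2 / c) * Real.exp (-(c / 2 * s))) := by
              gcongr; exact h1.trans h2
          _ = (1 + 2 / c) * (Real.exp (c * s) * Real.exp (-(c / 2 * s))) := by ring
          _ = _ := by rw [← Real.exp_add]; ring_nf
      refine (setLIntegral_mono' measurableSet_Iic hb).trans_lt ?_
      rw [lintegral_mul_const _ (by fun_prop)]
      refine ENNReal.mul_lt_top ?_ hMfin
      have hi : IntegrableOn (fun s => (1 + 2 / c) * Real.exp (c / 2 * s)) (Iic 0) :=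
        (integrableOn_exp_mul_Iic (by positivity) 0).const_mul _
      rw [← ofReal_integral_eq_lintegral_ofReal hi (ae_of_all _ fun s => by positivity)]
      exact ENNReal.ofReal_lt_top
    rw [lintegral_lintegral_swap hφ.aemeasurable] at hfin
    filter_upwards [ae_lt_top hφ.lintegral_prod_left' hfin.ne] with w hw
    refine ⟨(continuous_exp_mul_norm w.2.1 c).aestronglyMeasurable, ?_⟩
    rw [hasFiniteIntegral_iff_enorm]
    refine (lintegral_congr fun s => ?_).trans_lt hw
    simp only [φ]
    rw [enorm_mul, enorm_norm, Real.enorm_of_nonneg (Real.exp_nonneg _)]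
  filter_upwards [ae_all_iff.2 key] with w hw c hc
  obtain ⟨k, hk⟩ := exists_nat_one_div_lt hc
  refine (hw k).mono' (continuous_exp_mul_norm w.2.1 c).aestronglyMeasurable
    ((ae_restrict_iff' measurableSet_Iic).2 (ae_of_all _ fun s hs => ?_))
  rw [Real.norm_of_nonneg (by positivity)]
  gcongr ?_ * _
  exact Real.exp_le_exp.2 (mul_le_mul_of_nonpos_right hk.le hs)

end WienerGrowth

/-! ### The stationary Ornstein-Uhlenbeck process -/

section OrnsteinUhlenbeck

open NormedSpace Filter Topology

variable {E : Type*} [NormedAddCommGroup E] [NormedSpace ℝ E]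

/-- The convolution `∫_{-∞}ᵗ T e^{(t-s)T} w(s) ds`. -/
noncomputable def expConv (T : E →L[ℝ] E) (w : ℝ → E) (t : ℝ) : E :=
  ∫ s in Iic t, T (exp ((t - s) • T) (w s))

variable {T : E →L[ℝ] E} {b : ℝ} {w : ℝ → E}

theorem norm_expConv_le (hT : ∀ t : ℝ, 0 ≤ t → ∀ y, ‖exp (t • T) y‖ ≤ Real.exp (b * t) * ‖y‖)
    (hw : SubexpGrowth w) {c : ℝ} (hc : 0 < c) (hcb : c ≤ -b) {t : ℝ} (ht : t ≤ 0) :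
    ‖expConv T w t‖ ≤
      ‖T‖ * (∫ s in Iic (0 : ℝ), Real.exp (c * s) * ‖w s‖) * Real.exp (-(c * t)) := by
  have hsub : Iic t ⊆ Iic 0 := Iic_subset_Iic.2 ht
  have hb : ∀ s ∈ Iic t, ‖T (exp ((t - s) • T) (w s))‖ ≤
      ‖T‖ * Real.exp (-(c * t)) * (Real.exp (c * s) * ‖w s‖) := by
    intro s hs
    have hs : s ≤ t := hs
    have h1 : Real.exp (b * (t - s)) ≤ Real.exp (-(c * t)) * Real.exp (c * s) := by
      rw [← Real.exp_add]
      exact Real.exp_le_exp.2 (by nlinarith)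
    calc ‖T (exp ((t - s) • T) (w s))‖ ≤ ‖T‖ * (Real.exp (b * (t - s)) * ‖w s‖) :=
          (T.le_opNorm _).trans (by gcongr; exact hT _ (sub_nonneg.2 hs) _)
      _ ≤ ‖T‖ * (Real.exp (-(c * t)) * Real.exp (c * s) * ‖w s‖) := by gcongr
      _ = _ := by ring
  refine (norm_integral_le_of_norm_le (((hw c hc).mono_set hsub).const_mul _)
    ((ae_restrict_iff' measurableSet_Iic).2 (ae_of_all _ hb))).trans ?_
  rw [integral_const_mul, mul_right_comm]
  gcongr
  · exact ae_of_all _ fun s => by positivity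
  · exact hw c hc

variable [CompleteSpace E]

theorem continuous_exp_smul_apply {p : ℝ → E} {r : ℝ → ℝ} (hr : Continuous r)
    (hp : Continuous p) : Continuous fun s => exp (r s • T) (p s) :=
  ((continuous_exp_smul_clm T).comp hr).clm_apply hp

theorem integrableOn_expConv
    (hT : ∀ t : ℝ, 0 ≤ t → ∀ y, ‖exp (t • T) y‖ ≤ Real.exp (b * t) * ‖y‖) (hb : b < 0)
    (hwc : Continuous w) (hw : SubexpGrowth w) (t : ℝ) :
    IntegrableOn (fun s => T (exp ((t - s) • T) (w s))) (Iic t) := by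
  refine ((hw.integrableOn_Iic hwc (neg_pos.2 hb) t).const_mul (‖T‖ * Real.exp (b * t))).mono'
    (T.continuous.comp (continuous_exp_smul_apply (continuous_sub_left t)
      hwc)).aestronglyMeasurable
    ((ae_restrict_iff' measurableSet_Iic).2 (ae_of_all _ fun s hs => ?_))
  have hs : s ≤ t := hs
  calc ‖T (exp ((t - s) • T) (w s))‖ ≤ ‖T‖ * (Real.exp (b * (t - s)) * ‖w s‖) :=
        (T.le_opNorm _).trans (by gcongr; exact hT _ (sub_nonneg.2 hs) _)
    _ = ‖T‖ * (Real.exp (b * t) * Real.exp (-b * s) * ‖w s‖) := by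
        rw [← Real.exp_add]; ring_nf
    _ = _ := by ring

theorem hasDerivAt_expConv
    (hT : ∀ t : ℝ, 0 ≤ t → ∀ y, ‖exp (t • T) y‖ ≤ Real.exp (b * t) * ‖y‖) (hb : b < 0)
    (hwc : Continuous w) (hw : SubexpGrowth w) (t : ℝ) :
    HasDerivAt (expConv T w) (T (expConv T w t) + T (w t)) t := by
  have hc : Continuous fun s => exp ((-s) • T) (T (w s)) :=
    continuous_exp_smul_apply continuous_neg (T.continuous.comp hwc)
  have heq : expConv T w =
      fun t => exp (t • T) (expConv T w 0 + ∫ s in (0 : ℝ)..t, exp ((-s) • T) (T (w s))) := by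
    funext t
    have e : ∀ t s, T (exp ((t - s) • T) (w s)) = exp (t • T) (exp ((-s) • T) (T (w s))) := by
      intro t s
      rw [apply_exp_smul_comm, ← exp_add_smul_apply, sub_eq_add_neg]
    -- integrability of `e^{-sT} T w(s)` up to any time, by inverting `e^{tT}`
    have hi : ∀ r, IntegrableOn (fun s => exp ((-s) • T) (T (w s))) (Iic r) := by
      intro r
      refine ((exp ((-r) • T)).integrable_comp (integrableOn_expConv hT hb hwc hw r)).congr
        (ae_of_all _ fun s => ?_)
      simp only [e]
      rw [← exp_add_smul_apply, neg_add_cancel, exp_zero_smul_apply]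
    have h0 : expConv T w 0 = ∫ s in Iic (0 : ℝ), exp ((-s) • T) (T (w s)) := by
      simp only [expConv, apply_exp_smul_comm, zero_sub]
    rw [h0, ← intervalIntegral.integral_Iic_sub_Iic (hi 0) (hi t), add_sub_cancel,
      ← ContinuousLinearMap.integral_comp_comm _ (hi t)]
    simp only [expConv, e]
  have h1 := (intervalIntegral.integral_hasDerivAt_right (hc.intervalIntegrable 0 t)
    (hc.stronglyMeasurableAtFilter _ _) hc.continuousAt).const_add (expConv T w 0)
  have h2 : HasDerivAt (fun t => exp (t • T)
      (expConv T w 0 + ∫ s in (0 : ℝ)..t, exp ((-s) • T) (T (w s)))) _ t :=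
    (hasDerivAt_exp_smul_clm T t).clm_apply h1
  rw [← heq] at h2
  refine h2.congr_deriv ?_
  rw [← exp_add_smul_apply, add_neg_cancel, exp_zero_smul_apply, mul_apply_eq_comp,
    congrFun heq t]

theorem subexpGrowth_expConv
    (hT : ∀ t : ℝ, 0 ≤ t → ∀ y, ‖exp (t • T) y‖ ≤ Real.exp (b * t) * ‖y‖) (hb : b < 0)
    (hwc : Continuous w) (hw : SubexpGrowth w) : SubexpGrowth (expConv T w) := by
  intro c hc
  have hcont : Continuous (expConv T w) :=
    continuous_iff_continuousAt.2 fun t => (hasDerivAt_expConv hT hb hwc hw t).continuousAt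
  set d : ℝ := min (-b) (c / 2) with hd
  have hd0 : 0 < d := lt_min (neg_pos.2 hb) (by positivity)
  have hdc : 0 < c - d := by linarith [min_le_right (-b) (c / 2)]
  refine ((integrableOn_exp_mul_Iic hdc 0).const_mul
    (‖T‖ * ∫ s in Iic (0 : ℝ), Real.exp (d * s) * ‖w s‖)).mono'
    (continuous_exp_mul_norm hcont c).aestronglyMeasurable
    ((ae_restrict_iff' measurableSet_Iic).2 (ae_of_all _ fun s hs => ?_))
  rw [Real.norm_of_nonneg (by positivity)]
  refine (mul_le_mul_of_nonneg_left (norm_expConv_le hT hw hd0 (min_le_left _ _) hs)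
    (Real.exp_nonneg _)).trans_eq ?_
  rw [mul_left_comm, ← Real.exp_add]
  ring_nf

/-- For the increment path `w(· + t) - w(t)`, the convolution at time `0` is the one of `w` at
time `t`, up to the boundary term `w(t)`. -/
theorem integral_exp_increment
    (hT : ∀ t : ℝ, 0 ≤ t → ∀ y, ‖exp (t • T) y‖ ≤ Real.exp (b * t) * ‖y‖) (hb : b < 0)
    (hwc : Continuous w) (hw : SubexpGrowth w) (t : ℝ) :
    ∫ s in Iic (0 : ℝ), T (exp ((-s) • T) (w (s + t) - w t)) = expConv T w t + w t := by
  have h1 := integrableOn_expConv hT hb (hwc.comp (continuous_add_const t)) (hw.comp_add hwc t) 0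
  have h2 := integrableOn_expConv hT hb continuous_const (subexpGrowth_const (w t)) 0
  simp only [zero_sub, Function.comp_apply] at h1 h2
  simp only [map_sub]
  rw [integral_sub h1 h2]
  have e1 : ∫ s in Iic (0 : ℝ), T (exp ((-s) • T) (w (s + t))) = expConv T w t := by
    have := setIntegral_Iic_comp_add (fun s => T (exp ((t - s) • T) (w s))) t
    simp only [sub_add_cancel_right] at this
    exact this
  have e2 : ∫ s in Iic (0 : ℝ), T (exp ((-s) • T) (w t)) = -w t := by
    have hd : ∀ s ∈ Iic (0 : ℝ), HasDerivAt (fun s : ℝ => -exp ((-s) • T) (w t))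
        (T (exp ((-s) • T) (w t))) s := fun s _ => by
      have := (hasDerivAt_exp_smul_apply T (w t) (-s)).scomp s (hasDerivAt_neg s)
      rw [neg_one_smul] at this
      exact this.neg.congr_deriv (neg_neg _)
    have hlim : Tendsto (fun s : ℝ => -exp ((-s) • T) (w t)) atBot (𝓝 0) := by
      have hexp : Tendsto (fun s => Real.exp (-b * s) * ‖w t‖) atBot (𝓝 0) := by
        have := (Real.tendsto_exp_atBot.comp
          (tendsto_id.const_mul_atBot (neg_pos.2 hb))).mul_const ‖w t‖
        simpa using this
      refine squeeze_zero_norm' ?_ hexp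
      filter_upwards [eventually_le_atBot 0] with s hs
      rw [norm_neg]
      refine (hT (-s) (by linarith) _).trans_eq ?_
      ring_nf
    rw [integral_Iic_of_hasDerivAt_of_tendsto' hd h2 hlim, neg_zero, exp_zero_smul_apply, sub_zero]
  rw [e1, e2, sub_neg_eq_add]

end OrnsteinUhlenbeck

namespace SlowFastSystem

open NormedSpace

variable {n m : ℕ} (S : SlowFastSystem n m)

theorem exp_fast_le {β : ℝ} (hε : 0 < S.ε) (hB : ∀ t : ℝ, 0 ≤ t → ∀ y : Eucl m,
    ‖exp (t • S.B) y‖ ≤ Real.exp (β * t) * ‖y‖) (t : ℝ) (ht : 0 ≤ t) (y : Eucl m) :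
    ‖exp (t • S.ε⁻¹ • S.B) y‖ ≤ Real.exp (β / S.ε * t) * ‖y‖ := by
  have := hB (t * S.ε⁻¹) (by positivity) y
  rw [smul_smul]
  convert this using 3
  ring

/-- The stationary process is an exponential convolution of the path. -/
theorem ou_shift_eq {β : ℝ} (hε : 0 < S.ε) (hβ : β < 0) (hB : ∀ t : ℝ, 0 ≤ t → ∀ y : Eucl m,
    ‖exp (t • S.B) y‖ ≤ Real.exp (β * t) * ‖y‖) {ω : WienerPath m} (hω : SubexpGrowth ω.1)
    (t : ℝ) : S.ou (WienerPath.shift t ω) =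
      (S.σ / Real.sqrt S.ε) • (expConv (S.ε⁻¹ • S.B) ω.1 t + ω t) := by
  rw [← integral_exp_increment (S.exp_fast_le hε hB) (div_neg_of_neg_of_pos hβ hε) ω.2.1 hω t, ou,
    ← integral_smul]
  simp only [smul_smul, div_eq_mul_inv]
  rfl

theorem continuous_ou_shift {β : ℝ} (hε : 0 < S.ε) (hβ : β < 0)
    (hB : ∀ t : ℝ, 0 ≤ t → ∀ y : Eucl m, ‖exp (t • S.B) y‖ ≤ Real.exp (β * t) * ‖y‖)
    {ω : WienerPath m} (hω : SubexpGrowth ω.1) :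
    Continuous fun t => S.ou (WienerPath.shift t ω) := by
  simp only [S.ou_shift_eq hε hβ hB hω]
  have hJ : Continuous (expConv (S.ε⁻¹ • S.B) ω.1) := continuous_iff_continuousAt.2 fun t =>
    (hasDerivAt_expConv (S.exp_fast_le hε hB) (div_neg_of_neg_of_pos hβ hε) ω.2.1 hω t).continuousAt
  exact (hJ.add ω.2.1).const_smul (S.σ / Real.sqrt S.ε)

theorem subexpGrowth_ou_shift {β : ℝ} (hε : 0 < S.ε) (hβ : β < 0)
    (hB : ∀ t : ℝ, 0 ≤ t → ∀ y : Eucl m, ‖exp (t • S.B) y‖ ≤ Real.exp (β * t) * ‖y‖)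
    {ω : WienerPath m} (hω : SubexpGrowth ω.1) :
    SubexpGrowth fun t => S.ou (WienerPath.shift t ω) := by
  have hT := S.exp_fast_le hε hB
  have hb := div_neg_of_neg_of_pos hβ hε
  simp only [S.ou_shift_eq hε hβ hB hω]
  exact ((subexpGrowth_expConv hT hb ω.2.1 hω).add (continuous_iff_continuousAt.2 fun t =>
    (hasDerivAt_expConv hT hb ω.2.1 hω t).continuousAt) ω.2.1 hω).const_smul _

theorem measurable_ou : Measurable S.ou := by
  have hj : StronglyMeasurable fun p : WienerPath m × ℝ =>
      S.B (exp ((-p.2 / S.ε) • S.B) (p.1 p.2)) := by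
    have h1 : Measurable fun p : WienerPath m × ℝ =>
        (exp ((-p.2 / S.ε) • S.B), p.1 p.2) :=
      (((continuous_exp_smul_clm S.B).comp
        (continuous_neg.div_const S.ε)).measurable.comp measurable_snd).prodMk
        (WienerPath.measurable_uncurry_eval.comp measurable_swap)
    have h2 : Continuous fun q : (Eucl m →L[ℝ] Eucl m) × Eucl m => S.B (q.1 q.2) :=
      S.B.continuous.comp (continuous_fst.clm_apply continuous_snd)
    exact (h2.measurable.comp h1).stronglyMeasurable
  have := (hj.integral_prod_right' (ν := volume.restrict (Iic (0 : ℝ)))).measurable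
  exact (this.const_smul S.ε⁻¹).const_smul (S.σ / Real.sqrt S.ε)

theorem solvesOU {P : Measure (WienerPath m)} {β : ℝ} (hP : IsWienerMeasure P) (hε : 0 < S.ε)
    (hβ : β < 0) (hB : ∀ t : ℝ, 0 ≤ t → ∀ y : Eucl m,
      ‖exp (t • S.B) y‖ ≤ Real.exp (β * t) * ‖y‖) : S.SolvesOU P S.ou := by
  refine ⟨S.measurable_ou, ?_⟩
  filter_upwards [hP.ae_subexpGrowth] with ω hω
  refine ⟨S.continuous_ou_shift hε hβ hB hω, fun t => ?_⟩
  have hT := S.exp_fast_le hε hB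
  have hb := div_neg_of_neg_of_pos hβ hε
  have h0 : S.ou ω = S.ou (WienerPath.shift 0 ω) := by rw [WienerPath.shift_zero]
  rw [h0]
  simp only [S.ou_shift_eq hε hβ hB hω]
  set T : Eucl m →L[ℝ] Eucl m := S.ε⁻¹ • S.B
  set k : ℝ := S.σ / Real.sqrt S.ε
  have hJ : Continuous (expConv T ω.1) := continuous_iff_continuousAt.2 fun t =>
    (hasDerivAt_expConv hT hb ω.2.1 hω t).continuousAt
  have hFTC : (∫ s in (0 : ℝ)..t, (T (expConv T ω.1 s) + T (ω s))) =
      expConv T ω.1 t - expConv T ω.1 0 :=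
    intervalIntegral.integral_eq_sub_of_hasDerivAt
      (fun s _ => hasDerivAt_expConv hT hb ω.2.1 hω s)
      (((T.continuous.comp hJ).add (T.continuous.comp ω.2.1)).intervalIntegrable _ _)
  have hint : (∫ s in (0 : ℝ)..t, S.ε⁻¹ • S.B (k • (expConv T ω.1 s + ω s))) =
      k • (expConv T ω.1 t - expConv T ω.1 0) := by
    rw [← hFTC, ← intervalIntegral.integral_smul]
    refine intervalIntegral.integral_congr fun s _ => ?_
    change T (k • (expConv T ω.1 s + ω s)) = _
    rw [map_smul, map_add]
  rw [hint, ω.2.2]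
  simp only [smul_add, smul_sub, add_zero]
  abel

end SlowFastSystem

namespace SlowFastSystem

open NormedSpace Filter Topology NNReal

variable {n m : ℕ} {S : SlowFastSystem n m} {α β Lf Lg : ℝ}

/-! ### The random slow-fast system as a split system -/

variable (S α β Lf Lg) in
/-- The Lipschitz conditions on the nonlinearities and the exponential bounds on the linear
semigroups. -/
structure Admissible : Prop where
  ε_pos : 0 < S.ε
  α_nonneg : 0 ≤ α
  β_neg : β < 0
  Lf_nonneg : 0 ≤ Lf
  Lg_nonneg : 0 ≤ Lg
  f_lipschitz : ∀ (x x' : Eucl n) (y y' : Eucl m),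
    ‖S.f x y - S.f x' y'‖ ≤ Lf * (‖x - x'‖ + ‖y - y'‖)
  g_lipschitz : ∀ (x x' : Eucl n) (y y' : Eucl m),
    ‖S.g x y - S.g x' y'‖ ≤ Lg * (‖x - x'‖ + ‖y - y'‖)
  exp_A_le : ∀ t : ℝ, t ≤ 0 → ∀ x : Eucl n, ‖exp (t • S.A) x‖ ≤ Real.exp (α * t) * ‖x‖
  exp_B_le : ∀ t : ℝ, 0 ≤ t → ∀ y : Eucl m, ‖exp (t • S.B) y‖ ≤ Real.exp (β * t) * ‖y‖

theorem continuous_of_l1_lipschitz {E₁ E₂ E₃ : Type*} [NormedAddCommGroup E₁]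
    [NormedAddCommGroup E₂] [NormedAddCommGroup E₃] {f : E₁ → E₂ → E₃} {L : ℝ}
    (hf : ∀ x x' y y', ‖f x y - f x' y'‖ ≤ L * (‖x - x'‖ + ‖y - y'‖)) :
    Continuous (Function.uncurry f) := by
  refine continuous_iff_continuousAt.2 fun z => ?_
  rw [ContinuousAt, tendsto_iff_norm_sub_tendsto_zero]
  refine squeeze_zero (fun _ => norm_nonneg _) (fun z' => hf z'.1 z.1 z'.2 z.2) ?_
  have : Continuous fun z' : E₁ × E₂ => L * (‖z'.1 - z.1‖ + ‖z'.2 - z.2‖) := by fun_prop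
  simpa using this.tendsto z

namespace Admissible

theorem continuous_f (h : S.Admissible α β Lf Lg) : Continuous (Function.uncurry S.f) :=
  continuous_of_l1_lipschitz h.f_lipschitz

theorem continuous_g (h : S.Admissible α β Lf Lg) : Continuous (Function.uncurry S.g) :=
  continuous_of_l1_lipschitz h.g_lipschitz

theorem continuous_ou_shift (h : S.Admissible α β Lf Lg) {ω : WienerPath m}
    (hω : SubexpGrowth ω.1) :
    Continuous fun t => S.ou (WienerPath.shift t ω) :=
  S.continuous_ou_shift h.ε_pos h.β_neg h.exp_B_le hω

end Admissible

theorem l1Norm_add_right_sub {E₁ E₂ : Type*} [NormedAddCommGroup E₁] [NormedAddCommGroup E₂]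
    (z z' : E₁ × E₂) (y : E₂) :
    ‖z.1 - z'.1‖ + ‖z.2 + y - (z'.2 + y)‖ = l1Norm (z - z') := by
  rw [add_sub_add_right_eq_sub]
  rfl

/-- The random system for a fixed noise path, as a split system. -/
noncomputable def splitSystem (h : S.Admissible α β Lf Lg) (ω : WienerPath m)
    (hω : SubexpGrowth ω.1) : SplitSystem (Eucl n) (Eucl m) where
  A := S.A
  B := S.ε⁻¹ • S.B
  F := fun t z => S.F z.1 z.2 (WienerPath.shift t ω)
  G := fun t z => S.ε⁻¹ • S.G z.1 z.2 (WienerPath.shift t ω)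
  α := α
  β := β / S.ε
  L₁ := Lf
  L₂ := Lg / S.ε
  L₁_nonneg := h.Lf_nonneg
  L₂_nonneg := div_nonneg h.Lg_nonneg h.ε_pos.le
  continuous_F := h.continuous_f.comp ((continuous_fst.comp continuous_snd).prodMk
    ((continuous_snd.comp continuous_snd).add ((h.continuous_ou_shift hω).comp continuous_fst)))
  continuous_G := (h.continuous_g.comp ((continuous_fst.comp continuous_snd).prodMk
    ((continuous_snd.comp continuous_snd).add
      ((h.continuous_ou_shift hω).comp continuous_fst)))).const_smul S.ε⁻¹
  F_lipschitz := fun t z z' => (h.f_lipschitz _ _ _ _).trans_eq (by rw [l1Norm_add_right_sub])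
  G_lipschitz := fun t z z' => by
    rw [← smul_sub, norm_smul, Real.norm_of_nonneg (inv_nonneg.2 h.ε_pos.le), div_mul_eq_mul_div,
      inv_mul_eq_div]
    refine div_le_div_of_nonneg_right ((h.g_lipschitz _ _ _ _).trans_eq ?_) h.ε_pos.le
    rw [l1Norm_add_right_sub]
  exp_A_le := h.exp_A_le
  exp_B_le := S.exp_fast_le h.ε_pos h.exp_B_le

variable {h : S.Admissible α β Lf Lg} {ω : WienerPath m} {hω : SubexpGrowth ω.1} {lam : ℝ}

theorem splitSystem_shift (τ : ℝ) : (splitSystem h ω hω).shift τ =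
    splitSystem h (WienerPath.shift τ ω) (WienerPath.subexpGrowth_shift hω τ) := by
  simp only [splitSystem, SplitSystem.shift, WienerPath.shift_shift]

theorem isSolution_iff {Z : ℝ → Eucl n × Eucl m} :
    S.IsSolution ω Z ↔ (splitSystem h ω hω).IsSolutionOn (Ici 0) Z := by
  constructor
  · exact fun hZ t ht => (hZ t ht).1.prodMk (hZ t ht).2
  · exact fun hZ t ht => ⟨(hZ t ht).fst, (hZ t ht).snd⟩

theorem memCMinus_iff {u : ℝ → Eucl n × Eucl m} : MemCMinus lam u ↔ BackwardBounded lam u := by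
  refine and_congr Iff.rfl (exists_congr fun C => forall₂_congr fun t _ => ?_)
  rw [Real.exp_neg, inv_mul_le_iff₀ (Real.exp_pos _), mul_comm]
  rfl

theorem perronMap_eq (x₀ : Eucl n) :
    S.perronMap x₀ ω = (splitSystem h ω hω).perron x₀ := by
  funext u t
  refine Prod.ext rfl ?_
  simp only [perronMap, SplitSystem.perron, splitSystem, map_smul]
  rw [integral_smul]
  simp only [smul_smul, div_eq_mul_inv]

theorem isPerronFixedPoint_iff {x₀ : Eucl n} {u : ℝ → Eucl n × Eucl m} :
    S.IsPerronFixedPoint lam x₀ ω u ↔ (splitSystem h ω hω).IsPerronOrbit lam x₀ u := by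
  rw [IsPerronFixedPoint, perronMap_eq (h := h) (hω := hω), memCMinus_iff]
  rfl

/-- The forcing is controlled by the Ornstein-Uhlenbeck process, whose mean growth is
subexponential, while the weight `e^{-λs}` decays in the past. -/
theorem forcingIntegrable (hlam : lam < 0) : (splitSystem h ω hω).ForcingIntegrable lam := by
  have hou := S.subexpGrowth_ou_shift h.ε_pos h.β_neg h.exp_B_le hω (-lam) (neg_pos.2 hlam)
  have hc := (subexpGrowth_const (‖S.f 0 0‖ + S.ε⁻¹ * ‖S.g 0 0‖)) (-lam) (neg_pos.2 hlam)
  have hεi : 0 ≤ S.ε⁻¹ := inv_nonneg.2 h.ε_pos.le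
  refine (hc.add (hou.const_mul (Lf + S.ε⁻¹ * Lg))).mono' ?_ (ae_of_all _ fun s => ?_)
  · exact ((by fun_prop : Continuous fun s => Real.exp (-(lam * s))).mul
      (((splitSystem h ω hω).continuous_F.comp (Continuous.prodMk_left 0)).norm.add
      ((splitSystem h ω hω).continuous_G.comp (Continuous.prodMk_left 0)).norm)).aestronglyMeasurable
  · set y : Eucl m := S.ou (WienerPath.shift s ω) with hy
    have hF : ‖(splitSystem h ω hω).F s 0‖ ≤ ‖S.f 0 0‖ + Lf * ‖y‖ := by
      have h1 := h.f_lipschitz 0 0 (0 + y) 0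
      have h2 := norm_le_norm_add_norm_sub' (S.f 0 (0 + y)) (S.f 0 0)
      simp only [sub_self, norm_zero, zero_add, sub_zero] at h1 h2
      change ‖S.f 0 (0 + y)‖ ≤ _
      rw [zero_add]
      linarith
    have hG : ‖(splitSystem h ω hω).G s 0‖ ≤ S.ε⁻¹ * (‖S.g 0 0‖ + Lg * ‖y‖) := by
      have h1 := h.g_lipschitz 0 0 (0 + y) 0
      have h2 := norm_le_norm_add_norm_sub' (S.g 0 (0 + y)) (S.g 0 0)
      simp only [sub_self, norm_zero, zero_add, sub_zero] at h1 h2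
      change ‖S.ε⁻¹ • S.g 0 (0 + y)‖ ≤ _
      rw [zero_add, norm_smul, Real.norm_of_nonneg hεi]
      exact mul_le_mul_of_nonneg_left (by linarith) hεi
    rw [Real.norm_of_nonneg (by positivity), Pi.add_apply, neg_mul,
      Real.norm_of_nonneg (by positivity : 0 ≤ ‖S.f 0 0‖ + S.ε⁻¹ * ‖S.g 0 0‖)]
    refine (mul_le_mul_of_nonneg_left (add_le_add hF hG) (Real.exp_nonneg _)).trans_eq ?_
    ring

theorem SpectralGap.hasGap (hlam : lam < 0) (hgap : SpectralGap α β Lf Lg S.ε lam) :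
    (splitSystem h ω hω).HasGap lam := by
  obtain ⟨h1, -, h3⟩ := hgap
  have hε := h.ε_pos
  refine ⟨?_, hlam.trans_le h.α_nonneg, ?_⟩
  · change β / S.ε < lam
    rwa [div_lt_iff₀' hε]
  · change Lf / (α - lam) + Lg / S.ε / (lam - β / S.ε) < 1
    rwa [div_div, mul_sub, mul_div_cancel₀ _ hε.ne']

theorem exists_isPerronFixedPoint (h : S.Admissible α β Lf Lg) (hω : SubexpGrowth ω.1)
    (hlam : lam < 0) (hgap : SpectralGap α β Lf Lg S.ε lam) (x₀ : Eucl n) :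
    ∃ u, S.IsPerronFixedPoint lam x₀ ω u := by
  obtain ⟨u, hu, -⟩ := SplitSystem.exists_isPerronOrbit (N := splitSystem h ω hω)
    (hgap.hasGap hlam) (forcingIntegrable hlam) x₀
  exact ⟨u, isPerronFixedPoint_iff.2 hu⟩

theorem isPerronFixedPoint_perronOrbit (h : S.Admissible α β Lf Lg) (hω : SubexpGrowth ω.1)
    (hlam : lam < 0) (hgap : SpectralGap α β Lf Lg S.ε lam) (x₀ : Eucl n) :
    S.IsPerronFixedPoint lam x₀ ω (S.perronOrbit lam x₀ ω) := by
  have hex := exists_isPerronFixedPoint h hω hlam hgap x₀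
  rw [perronOrbit, dif_pos hex]
  exact hex.choose_spec

theorem perronOrbit_zero (h : S.Admissible α β Lf Lg) (hω : SubexpGrowth ω.1)
    (hlam : lam < 0) (hgap : SpectralGap α β Lf Lg S.ε lam) (x₀ : Eucl n) :
    S.perronOrbit lam x₀ ω 0 = (x₀, S.slowMap lam x₀ ω) := by
  rw [(isPerronFixedPoint_perronOrbit h hω hlam hgap x₀).2 0 le_rfl]
  simp [perronMap, slowMap, -zero_smul, exp_zero_smul_apply]

theorem slowManifold_eq (h : S.Admissible α β Lf Lg) (hω : SubexpGrowth ω.1)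
    (hlam : lam < 0) (hgap : SpectralGap α β Lf Lg S.ε lam) :
    S.slowManifold lam ω = (splitSystem h ω hω).manifold lam := by
  have hp := fun x₀ => isPerronFixedPoint_perronOrbit h hω hlam hgap x₀
  ext z
  constructor
  · rintro ⟨x, rfl⟩
    exact ⟨_, isPerronFixedPoint_iff.1 (hp x), perronOrbit_zero h hω hlam hgap x⟩
  · rintro ⟨u, hu, hu0⟩
    refine ⟨z.1, ?_⟩
    have := hu.unique (hgap.hasGap hlam) (forcingIntegrable hlam)
      (isPerronFixedPoint_iff.1 (hp z.1)) self_mem_Iic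
    exact (perronOrbit_zero h hω hlam hgap z.1).symm.trans (this.symm.trans hu0)

/-! ### Measurability -/

theorem _root_.MeasureTheory.StronglyMeasurable.setIntegral_section {X E : Type*}
    [MeasurableSpace X] [NormedAddCommGroup E] [NormedSpace ℝ E] {k : X × ℝ → E}
    (hk : StronglyMeasurable k) {D : Set (X × ℝ)} (hD : MeasurableSet D) :
    StronglyMeasurable fun p => ∫ s in {s | (p, s) ∈ D}, k (p, s) := by
  have h1 := (hk.indicator hD).integral_prod_right' (ν := (volume : Measure ℝ))
  convert h1 using 2 with p
  exact (integral_indicator (f := fun s => k (p, s)) (measurable_prodMk_left hD)).symm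

theorem measurable_uncurry_perronMap (h : S.Admissible α β Lf Lg) (x₀ : Eucl n)
    {u : WienerPath m → ℝ → Eucl n × Eucl m} (hu : Measurable (Function.uncurry u)) :
    Measurable (Function.uncurry fun ω t => S.perronMap x₀ ω (u ω) t) := by
  have hou : Measurable fun q : (WienerPath m × ℝ) × ℝ =>
      S.ou (WienerPath.shift q.2 q.1.1) :=
    S.measurable_ou.comp (WienerPath.measurable_uncurry_shift.comp
      (measurable_snd.prodMk (measurable_fst.comp measurable_fst)))
  have hus : Measurable fun q : (WienerPath m × ℝ) × ℝ => u q.1.1 q.2 :=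
    hu.comp ((measurable_fst.comp measurable_fst).prodMk measurable_snd)
  have hF : Measurable fun q : (WienerPath m × ℝ) × ℝ =>
      S.F (u q.1.1 q.2).1 (u q.1.1 q.2).2 (WienerPath.shift q.2 q.1.1) :=
    h.continuous_f.measurable.comp ((measurable_fst.comp hus).prodMk
      ((measurable_snd.comp hus).add hou))
  have hG : Measurable fun q : (WienerPath m × ℝ) × ℝ =>
      S.G (u q.1.1 q.2).1 (u q.1.1 q.2).2 (WienerPath.shift q.2 q.1.1) :=
    h.continuous_g.measurable.comp ((measurable_fst.comp hus).prodMk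
      ((measurable_snd.comp hus).add hou))
  have hexp : ∀ {d : ℕ} (T : Eucl d →L[ℝ] Eucl d) {r : (WienerPath m × ℝ) × ℝ → ℝ}
      {p : (WienerPath m × ℝ) × ℝ → Eucl d}, Measurable r → Measurable p →
      StronglyMeasurable fun q => exp (r q • T) (p q) := by
    intro d T r p hr hp
    have hc : Continuous fun q : (Eucl d →L[ℝ] Eucl d) × Eucl d => q.1 q.2 :=
      continuous_fst.clm_apply continuous_snd
    exact (hc.measurable.comp
      (((continuous_exp_smul_clm T).measurable.comp hr).prodMk hp)).stronglyMeasurable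
  have hts : Measurable fun q : (WienerPath m × ℝ) × ℝ => q.1.2 - q.2 :=
    (measurable_snd.comp measurable_fst).sub measurable_snd
  have hk1 := hexp S.A hts hF
  have hk2 := hexp S.B (hts.div_const S.ε) hG
  have mt : Measurable fun q : (WienerPath m × ℝ) × ℝ => q.1.2 := measurable_snd.comp measurable_fst
  have i1 := hk1.setIntegral_section (D := {q | 0 < q.2 ∧ q.2 ≤ q.1.2})
    ((measurableSet_lt measurable_const measurable_snd).inter (measurableSet_le measurable_snd mt))
  have i2 := hk1.setIntegral_section (D := {q | q.1.2 < q.2 ∧ q.2 ≤ 0})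
    ((measurableSet_lt mt measurable_snd).inter (measurableSet_le measurable_snd measurable_const))
  have i3 := hk2.setIntegral_section (D := {q | q.2 ≤ q.1.2}) (measurableSet_le measurable_snd mt)
  have m0 : Measurable fun p : WienerPath m × ℝ => exp (p.2 • S.A) x₀ :=
    ((continuous_exp_smul_clm S.A).clm_apply continuous_const).measurable.comp measurable_snd
  exact (m0.add (i1.measurable.sub i2.measurable)).prodMk (i3.measurable.const_smul S.ε⁻¹)

theorem measurable_uncurry_picard (h : S.Admissible α β Lf Lg) (x₀ : Eucl n) (k : ℕ) :
    Measurable (Function.uncurry fun ω t => ((S.perronMap x₀ ω)^[k] fun _ => 0) t) := by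
  induction k with
  | zero => exact measurable_const
  | succ k ih =>
    simp only [Function.iterate_succ_apply']
    exact measurable_uncurry_perronMap h x₀ ih

theorem aemeasurable_slowMap {P : Measure (WienerPath m)} (h : S.Admissible α β Lf Lg)
    (hP : ∀ᵐ ω ∂P, SubexpGrowth ω.1) (hlam : lam < 0)
    (hgap : SpectralGap α β Lf Lg S.ε lam) (x₀ : Eucl n) :
    AEMeasurable (fun ω => S.slowMap lam x₀ ω) P := by
  refine aemeasurable_of_tendsto_metrizable_ae atTop
    (f := fun k ω => (((S.perronMap x₀ ω)^[k] fun _ => 0) 0).2) (fun k => ?_) ?_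
  · exact (measurable_snd.comp ((measurable_uncurry_picard h x₀ k).comp
      measurable_prodMk_right)).aemeasurable
  · filter_upwards [hP] with ω hω
    obtain ⟨u, hu, hlim⟩ := SplitSystem.exists_isPerronOrbit (N := splitSystem h ω hω)
      (hgap.hasGap hlam) (forcingIntegrable hlam) x₀
    have h1 := hu.unique (hgap.hasGap hlam) (forcingIntegrable hlam) (isPerronFixedPoint_iff.1
      (isPerronFixedPoint_perronOrbit h hω hlam hgap x₀)) self_mem_Iic
    have h2 := (hlim 0 le_rfl).snd_nhds
    rw [h1, perronOrbit_zero h hω hlam hgap] at h2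
    rwa [← perronMap_eq (h := h) (hω := hω)] at h2

end SlowFastSystem

namespace SlowFastSystem

open NormedSpace Filter Topology NNReal

variable {n m : ℕ} {S : SlowFastSystem n m} {α β Lf Lg lam : ℝ} {ω : WienerPath m}

/-! ### The solution map -/

theorem flow_spec (h : S.Admissible α β Lf Lg) (hω : SubexpGrowth ω.1) (z : Eucl n × Eucl m) :
    S.IsSolution ω (fun t => S.flow t ω z) ∧ S.flow 0 ω z = z := by
  obtain ⟨Z, hZ0, hZ⟩ := (splitSystem h ω hω).exists_isSolutionOn_Ici z
  have hex : ∃ Z, S.IsSolution ω Z ∧ Z 0 = z := ⟨Z, isSolution_iff.2 hZ, hZ0⟩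
  have heq : (fun t => S.flow t ω z) = hex.choose := by
    funext t
    rw [flow, dif_pos hex]
  exact ⟨heq ▸ hex.choose_spec.1, (congrFun heq 0).trans hex.choose_spec.2⟩

theorem IsSolution.eq_of_eq (h : S.Admissible α β Lf Lg) (hω : SubexpGrowth ω.1)
    {Z Z' : ℝ → Eucl n × Eucl m} (hZ : S.IsSolution ω Z) (hZ' : S.IsSolution ω Z')
    (h0 : Z 0 = Z' 0) {t : ℝ} (ht : 0 ≤ t) : Z t = Z' t := by
  have h1 := (isSolution_iff (h := h) (hω := hω)).1 hZ
  have h2 := (isSolution_iff (h := h) (hω := hω)).1 hZ'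
  exact (h1.mono Icc_subset_Ici_self).eqOn_Icc (h2.mono Icc_subset_Ici_self) h0 ⟨ht, le_rfl⟩

theorem IsSolution.mem_slowManifold (h : S.Admissible α β Lf Lg) (hω : SubexpGrowth ω.1)
    (hlam : lam < 0) (hgap : SpectralGap α β Lf Lg S.ε lam) {Z : ℝ → Eucl n × Eucl m}
    (hZ : S.IsSolution ω Z) (h0 : Z 0 ∈ S.slowManifold lam ω) {t : ℝ} (ht : 0 ≤ t) :
    Z t ∈ S.slowManifold lam (WienerPath.shift t ω) := by
  rw [slowManifold_eq h hω hlam hgap] at h0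
  rw [slowManifold_eq h (WienerPath.subexpGrowth_shift hω t) hlam hgap,
    ← splitSystem_shift (h := h) (hω := hω)]
  exact (isSolution_iff.1 hZ).mem_manifold (hgap.hasGap hlam).1 ht (forcingIntegrable hlam)
    (by rw [splitSystem_shift]; exact forcingIntegrable hlam) h0

theorem eq_slowMap_of_mem_slowManifold {z : Eucl n × Eucl m} (hz : z ∈ S.slowManifold lam ω) :
    z.2 = S.slowMap lam z.1 ω := by
  obtain ⟨x, rfl⟩ := hz
  rfl

/-! ### Consequences of the gap condition -/

/-- The gap condition provides a rate `μ < 0` which satisfies the spectral gap condition and lies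
strictly above the decay rate outside the cone of aperture `δ`; the latter persists for a slightly
smaller aperture `δ'`. -/
theorem exists_rate_of_gap {ε δ : ℝ} (hε : 0 < ε) (hα : 0 ≤ α) (hLf : 0 ≤ Lf) (hLg : 0 ≤ Lg)
    (hδ : 0 < δ) (hgap : ε * α + ε * Lf + ε * δ * Lf + β + Lg + δ⁻¹ * Lg < 0) :
    ∃ μ < 0, SpectralGap α β Lf Lg ε μ ∧
      (β + Lg + δ⁻¹ * Lg) / ε ≤ α - Lf - δ * Lf ∧
      ∃ δ', 0 < δ' ∧ δ' < δ ∧ (β + Lg + δ'⁻¹ * Lg) / ε < μ ∧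
        (β + Lg + δ'⁻¹ * Lg) / ε ≤ α - Lf - δ' * Lf := by
  have hδLf : 0 ≤ δ * Lf := by positivity
  have hδLg : 0 ≤ δ⁻¹ * Lg := by positivity
  set r : ℝ := (β + Lg + δ⁻¹ * Lg) / ε with hr
  have hrε : β + Lg + δ⁻¹ * Lg = ε * r := by rw [hr]; field_simp
  have hrq : r < -(α + Lf + δ * Lf) := by
    rw [hr, div_lt_iff₀ hε]
    linarith
  obtain ⟨μ, hrμ, hμq⟩ := exists_between hrq
  have hεμ : ε * r < ε * μ := mul_lt_mul_of_pos_left hrμ hε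
  have hμ0 : μ < 0 := by linarith
  have hεμ0 : ε * μ < 0 := mul_neg_of_pos_of_neg hε hμ0
  refine ⟨μ, hμ0, ⟨by linarith, by linarith, ?_⟩, by linarith, ?_⟩
  · have h1 : Lf / (α - μ) < 1 / (1 + δ) := by
      rw [div_lt_div_iff₀ (by linarith) (by linarith)]
      linarith
    have h2 : Lg / (ε * μ - β) < δ / (1 + δ) := by
      have h3 : δ * (δ⁻¹ * Lg) = Lg := by field_simp
      have h4 : δ * (Lg + δ⁻¹ * Lg) < δ * (ε * μ - β) :=
        mul_lt_mul_of_pos_left (by linarith) hδ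
      rw [div_lt_div_iff₀ (by linarith) (by linarith)]
      linarith
    have h3 : 1 / (1 + δ) + δ / (1 + δ) = 1 := by field_simp
    linarith
  · set c : ℝ := ε * μ - β - Lg with hc
    have hc0 : δ⁻¹ * Lg < c := by linarith
    have hcpos : 0 < c := hδLg.trans_lt hc0
    have hLgc : Lg / c < δ := by
      rw [div_lt_iff₀ hcpos]
      rwa [inv_mul_lt_iff₀ hδ] at hc0
    obtain ⟨δ', h1, h2⟩ := exists_between hLgc
    have hδ' : 0 < δ' := (div_nonneg hLg hcpos.le).trans_lt h1
    have h3 : δ'⁻¹ * Lg < c := by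
      rw [div_lt_iff₀ hcpos] at h1
      rwa [inv_mul_lt_iff₀ hδ']
    have h4 : (β + Lg + δ'⁻¹ * Lg) / ε < μ := by
      rw [div_lt_iff₀ hε]
      linarith
    have h5 : δ' * Lf ≤ δ * Lf := by gcongr
    exact ⟨δ', hδ', h2, h4, by linarith⟩

theorem rate_splitSystem {h : S.Admissible α β Lf Lg} {hω : SubexpGrowth ω.1} (δ : ℝ) :
    (splitSystem h ω hω).rate δ = (β + Lg + δ⁻¹ * Lg) / S.ε := by
  simp only [SplitSystem.rate, splitSystem]
  ring

theorem manifold_splitSystem_eq {h : S.Admissible α β Lf Lg} {hω : SubexpGrowth ω.1} {μ : ℝ}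
    (hlam : lam < 0) (hgap : SpectralGap α β Lf Lg S.ε lam) (hμ0 : μ < 0)
    (hμ : SpectralGap α β Lf Lg S.ε μ) :
    (splitSystem h ω hω).manifold lam = (splitSystem h ω hω).manifold μ := by
  rcases le_total lam μ with hle | hle
  · exact (SplitSystem.manifold_eq_of_le hle (hμ.hasGap hμ0) (hgap.hasGap hlam)
      (forcingIntegrable hμ0) (forcingIntegrable hlam)).symm
  · exact SplitSystem.manifold_eq_of_le hle (hgap.hasGap hlam) (hμ.hasGap hμ0)
      (forcingIntegrable hlam) (forcingIntegrable hμ0)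

theorem exists_lipschitzWith_slowMap {δ : ℝ} (h : S.Admissible α β Lf Lg) (hlam : lam < 0)
    (hsg : SpectralGap α β Lf Lg S.ε lam) (hδ : 0 < δ)
    (hgap : S.ε * α + S.ε * Lf + S.ε * δ * Lf + β + Lg + δ⁻¹ * Lg < 0) :
    ∃ K : ℝ≥0, ∀ ω : WienerPath m, SubexpGrowth ω.1 →
      LipschitzWith K fun x => S.slowMap lam x ω := by
  obtain ⟨μ, hμ0, hμ, -, δ', hδ'0, -, hrate, hcone⟩ :=
    exists_rate_of_gap h.ε_pos h.α_nonneg h.Lf_nonneg h.Lg_nonneg hδ hgap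
  refine ⟨δ'.toNNReal, fun ω hω => LipschitzWith.of_dist_le_mul fun x x' => ?_⟩
  have hM : ∀ x, (x, S.slowMap lam x ω) ∈ (splitSystem h ω hω).manifold μ := fun x => by
    rw [← manifold_splitSystem_eq hlam hsg hμ0 hμ, ← slowManifold_eq h hω hlam hsg]
    exact mem_range_self x
  have hc : (splitSystem h ω hω).ConeCondition δ' := ⟨hδ'0, by rwa [rate_splitSystem]⟩
  have hr : (splitSystem h ω hω).rate δ' < μ := by rwa [rate_splitSystem]
  have := SplitSystem.norm_snd_sub_le_of_mem_manifold hc hr (hμ.hasGap hμ0).1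
    (forcingIntegrable hμ0) (hM x) (hM x')
  rwa [dist_eq_norm, dist_eq_norm, Real.coe_toNNReal _ hδ'0.le]

/-- The constant is `1 + δ⁻¹`, because the difference of the two solutions stays outside the cone of
aperture `δ`, where its slow component is at most `δ⁻¹` times the fast one. -/
theorem exists_tracking_slowManifold {δ : ℝ} (h : S.Admissible α β Lf Lg) (hlam : lam < 0)
    (hsg : SpectralGap α β Lf Lg S.ε lam) (hδ : 0 < δ)
    (hgap : S.ε * α + S.ε * Lf + S.ε * δ * Lf + β + Lg + δ⁻¹ * Lg < 0)
    (hω : SubexpGrowth ω.1) {Z : ℝ → Eucl n × Eucl m} (hZ : S.IsSolution ω Z) :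
    ∃ Z', S.IsSolution ω Z' ∧ Z' 0 ∈ S.slowManifold lam ω ∧ ∀ t, 0 ≤ t →
      sumNorm (Z t - Z' t) ≤ (1 + δ⁻¹) * sumNorm (Z 0 - Z' 0) *
        Real.exp (-(-β - Lg - δ⁻¹ * Lg) * t / S.ε) := by
  obtain ⟨μ, hμ0, hμ, hcone, δ', hδ'0, hδ', hrate, hcone'⟩ :=
    exists_rate_of_gap h.ε_pos h.α_nonneg h.Lf_nonneg h.Lg_nonneg hδ hgap
  obtain ⟨Z', hZ', hmem, hdec⟩ := SplitSystem.exists_tracking_solution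
    (N := splitSystem h ω hω) (δ := δ) (δ' := δ') ⟨hδ, by rwa [rate_splitSystem]⟩
    ⟨hδ'0, by rwa [rate_splitSystem]⟩ hδ' (by rwa [rate_splitSystem]) (hμ.hasGap hμ0)
    (forcingIntegrable hμ0) (fun τ _ => by rw [splitSystem_shift]; exact forcingIntegrable hμ0)
    (isSolution_iff.1 hZ)
  refine ⟨Z', isSolution_iff.2 hZ', ?_, fun t ht => ?_⟩
  · rwa [slowManifold_eq h hω hlam hsg, manifold_splitSystem_eq hlam hsg hμ0 hμ]
  obtain ⟨h1, h2⟩ := hdec t ht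
  rw [rate_splitSystem] at h2
  have e : (β + Lg + δ⁻¹ * Lg) / S.ε * t = -(-β - Lg - δ⁻¹ * Lg) * t / S.ε := by ring
  rw [e] at h2
  have h3 : ‖(Z t).1 - (Z' t).1‖ ≤ δ⁻¹ * ‖(Z t).2 - (Z' t).2‖ := by rwa [le_inv_mul_iff₀ hδ]
  have h4 : ‖(Z 0).2 - (Z' 0).2‖ ≤ sumNorm (Z 0 - Z' 0) := le_add_of_nonneg_left (norm_nonneg _)
  set x := Real.exp (-(-β - Lg - δ⁻¹ * Lg) * t / S.ε)
  calc sumNorm (Z t - Z' t) = ‖(Z t).1 - (Z' t).1‖ + ‖(Z t).2 - (Z' t).2‖ := rfl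
    _ ≤ (1 + δ⁻¹) * ‖(Z t).2 - (Z' t).2‖ := by linarith
    _ ≤ (1 + δ⁻¹) * (sumNorm (Z 0 - Z' 0) * x) := by
        gcongr
        exact h2.trans (by gcongr)
    _ = _ := by ring

/-! ### The slow manifold as a random set -/

theorem iInf_sumNorm_slowManifold {K : ℝ≥0} (hK : LipschitzWith K fun x => S.slowMap lam x ω)
    (z : Eucl n × Eucl m) :
    ⨅ z' : ↥(S.slowManifold lam ω), sumNorm (z - (z' : Eucl n × Eucl m)) =
      ⨅ k : ℕ, sumNorm (z - (TopologicalSpace.denseSeq (Eucl n) k,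
        S.slowMap lam (TopologicalSpace.denseSeq (Eucl n) k) ω)) := by
  set φ : Eucl n → ℝ := fun x => sumNorm (z - (x, S.slowMap lam x ω)) with hφ
  have hφ0 : ∀ x, 0 ≤ φ x := fun x => add_nonneg (norm_nonneg _) (norm_nonneg _)
  have hφc : Continuous φ :=
    continuous_l1Norm.comp (continuous_const.sub (continuous_id.prodMk hK.continuous))
  have hb : BddBelow (range φ) := ⟨0, by rintro _ ⟨x, rfl⟩; exact hφ0 x⟩
  have hbs : BddBelow (range fun k => φ (TopologicalSpace.denseSeq (Eucl n) k)) :=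
    ⟨0, by rintro _ ⟨k, rfl⟩; exact hφ0 _⟩
  have h1 : ⨅ z' : ↥(S.slowManifold lam ω), sumNorm (z - (z' : Eucl n × Eucl m)) = ⨅ x, φ x :=
    (rangeFactorization_surjective (f := fun x => (x, S.slowMap lam x ω))).iInf_comp
      (fun z' : ↥(S.slowManifold lam ω) => sumNorm (z - (z' : Eucl n × Eucl m))) |>.symm
  rw [h1]
  refine le_antisymm (le_ciInf fun k => ciInf_le hb _) (le_ciInf fun x => ?_)
  exact (TopologicalSpace.denseRange_denseSeq (Eucl n)).induction_on x
    (isClosed_le continuous_const hφc) fun k => ciInf_le hbs k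

theorem isRandomSet_slowManifold {P : Measure (WienerPath m)} (h : S.Admissible α β Lf Lg)
    (hP : ∀ᵐ ω ∂P, SubexpGrowth ω.1) (hlam : lam < 0) (hsg : SpectralGap α β Lf Lg S.ε lam)
    {K : ℝ≥0} (hK : ∀ ω : WienerPath m, SubexpGrowth ω.1 →
      LipschitzWith K fun x => S.slowMap lam x ω) : IsRandomSet P (S.slowManifold lam) where
  nonempty_closed := by
    filter_upwards [hP] with ω hω
    refine ⟨range_nonempty _, ?_⟩
    have : S.slowManifold lam ω = {z | z.2 = S.slowMap lam z.1 ω} :=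
      Subset.antisymm (fun z hz => eq_slowMap_of_mem_slowManifold hz)
        fun z hz => ⟨z.1, Prod.ext rfl (Eq.symm hz)⟩
    rw [this]
    exact isClosed_eq continuous_snd ((hK ω hω).continuous.comp continuous_fst)
  dist_measurable := fun z => by
    refine AEMeasurable.congr (f := fun ω => ⨅ k : ℕ, sumNorm (z -
      (TopologicalSpace.denseSeq (Eucl n) k,
        S.slowMap lam (TopologicalSpace.denseSeq (Eucl n) k) ω))) (AEMeasurable.iInf fun k => ?_) ?_
    · exact (continuous_l1Norm.measurable.comp_aemeasurable
        ((aemeasurable_const.prodMk (aemeasurable_slowMap h hP hlam hsg _)).const_sub z))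
    · filter_upwards [hP] with ω hω
      rw [iInf_sumNorm_slowManifold (hK ω hω)]

theorem isAsymptoticallyComplete_slowManifold {P : Measure (WienerPath m)} {δ : ℝ}
    (h : S.Admissible α β Lf Lg) (hP : ∀ᵐ ω ∂P, SubexpGrowth ω.1) (hlam : lam < 0)
    (hsg : SpectralGap α β Lf Lg S.ε lam) (hδ : 0 < δ)
    (hgap : S.ε * α + S.ε * Lf + S.ε * δ * Lf + β + Lg + δ⁻¹ * Lg < 0)
    (hγ : 0 < -β - Lg - δ⁻¹ * Lg) :
    IsAsymptoticallyComplete P S.flow (S.slowManifold lam) := by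
  obtain ⟨K, hK⟩ := exists_lipschitzWith_slowMap h hlam hsg hδ hgap
  refine ⟨⟨isRandomSet_slowManifold h hP hlam hsg hK, ?_, ?_⟩, ?_⟩
  · filter_upwards [hP] with ω hω t ht z hz
    obtain ⟨h1, h2⟩ := flow_spec h hω z
    exact h1.mem_slowManifold h hω hlam hsg (by rwa [h2]) ht
  · refine ⟨S.slowMap lam, K, aemeasurable_slowMap h hP hlam hsg, ?_⟩
    filter_upwards [hP] with ω hω
    exact ⟨hK ω hω, rfl⟩
  · refine ⟨(-β - Lg - δ⁻¹ * Lg) / S.ε, div_pos hγ h.ε_pos, fun _ => 1 + δ⁻¹, measurable_const,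
      fun _ => by positivity, ?_⟩
    filter_upwards [hP] with ω hω z
    obtain ⟨h1, h2⟩ := flow_spec h hω z
    obtain ⟨Z', hZ', hmem, hdec⟩ := exists_tracking_slowManifold h hlam hsg hδ hgap hω h1
    refine ⟨Z' 0, hmem, fun t ht => ?_⟩
    obtain ⟨h3, h4⟩ := flow_spec h hω (Z' 0)
    rw [h3.eq_of_eq h hω hZ' h4 ht]
    have := hdec t ht
    rw [h2] at this
    refine this.trans_eq ?_
    ring_nf

end SlowFastSystem

theorem mainTheorem3 {n m : ℕ} (S : SlowFastSystem n m)
    (P : Measure (WienerPath m)) (hP : IsWienerMeasure P)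
    (α β Lf Lg δ : ℝ)
    (hε : 0 < S.ε) (hε1 : S.ε ≤ 1) (hα : 0 ≤ α) (hβ : β < 0) (hLf : 0 ≤ Lf) (hLg : 0 ≤ Lg)
    -- `f` and `g` are Lipschitz with constants `L_f` and `L_g`
    (hf : ∀ (x x' : Eucl n) (y y' : Eucl m),
      ‖S.f x y - S.f x' y'‖ ≤ Lf * (‖x - x'‖ + ‖y - y'‖))
    (hg : ∀ (x x' : Eucl n) (y y' : Eucl m),
      ‖S.g x y - S.g x' y'‖ ≤ Lg * (‖x - x'‖ + ‖y - y'‖))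
    -- the bounds on the linear semigroups
    (hH1A : ∀ t : ℝ, t ≤ 0 → ∀ x : Eucl n,
      ‖NormedSpace.exp (t • S.A) x‖ ≤ Real.exp (α * t) * ‖x‖)
    (hH1B : ∀ t : ℝ, 0 ≤ t → ∀ y : Eucl m,
      ‖NormedSpace.exp (t • S.B) y‖ ≤ Real.exp (β * t) * ‖y‖)
    -- the spectral gap condition
    (hH2 : ∀ ε : ℝ, 0 < ε → ε ≤ 1 → ∃ lam : ℝ, SlowFastSystem.SpectralGap α β Lf Lg ε lam)
    -- the gap condition
    (hδ : 0 < δ)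
    (hgap : S.ε * α + S.ε * Lf + S.ε * δ * Lf + β + Lg + δ⁻¹ * Lg < 0) :
    0 < -β - Lg - δ⁻¹ * Lg ∧
    -- `η^ε` solves the Ornstein-Uhlenbeck equation
    S.SolvesOU P S.ou ∧
    -- the random system is well posed, with solution map `flow`
    (∀ᵐ ω ∂P, ∀ z : Eucl n × Eucl m,
      S.IsSolution ω (fun t => S.flow t ω z) ∧ S.flow 0 ω z = z ∧
      ∀ Z, S.IsSolution ω Z → Z 0 = z → ∀ t : ℝ, 0 ≤ t → Z t = S.flow t ω z) ∧
    (∃ lam : ℝ, lam < 0 ∧ SlowFastSystem.SpectralGap α β Lf Lg S.ε lam) ∧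
    ∀ lam : ℝ, lam < 0 → SlowFastSystem.SpectralGap α β Lf Lg S.ε lam →
      -- the Lyapunov-Perron map has a unique fixed point, so `h^ε` is well defined
      (∀ᵐ ω ∂P, ∀ X0 : Eucl n,
        S.IsPerronFixedPoint lam X0 ω (S.perronOrbit lam X0 ω) ∧
        ∀ u, S.IsPerronFixedPoint lam X0 ω u →
          ∀ t : ℝ, t ≤ 0 → u t = S.perronOrbit lam X0 ω t) ∧
      -- the random manifold is almost surely asymptotically complete
      IsAsymptoticallyComplete P S.flow (S.slowManifold lam) ∧
      -- exponential attraction to orbits on the manifold, governed by the reduced equation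
      ∃ D : ℝ, 0 < D ∧ ∀ᵐ ω ∂P, ∀ Z : ℝ → Eucl n × Eucl m, S.IsSolution ω Z →
        ∃ Z' : ℝ → Eucl n × Eucl m,
          S.IsSolution ω Z' ∧
          (∀ t : ℝ, 0 ≤ t → Z' t ∈ S.slowManifold lam (WienerPath.shift t ω)) ∧
          S.IsReducedSolution lam ω (fun t => (Z' t).1) ∧
          (∀ t : ℝ, 0 ≤ t → (Z' t).2 = S.slowMap lam (Z' t).1 (WienerPath.shift t ω)) ∧
          ∀ t : ℝ, 0 ≤ t →
            sumNorm (Z t - Z' t) ≤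
              D * sumNorm (Z 0 - Z' 0) * Real.exp (-(-β - Lg - δ⁻¹ * Lg) * t / S.ε) := by
  have h : S.Admissible α β Lf Lg := ⟨hε, hα, hβ, hLf, hLg, hf, hg, hH1A, hH1B⟩
  have hγ : 0 < -β - Lg - δ⁻¹ * Lg := by
    have h1 : 0 ≤ S.ε * α := by positivity
    have h2 : 0 ≤ S.ε * Lf := by positivity
    have h3 : 0 ≤ S.ε * δ * Lf := by positivity
    linarith
  have hgrowth := hP.ae_subexpGrowth
  refine ⟨hγ, S.solvesOU hP hε hβ hH1B, ?_, ?_, fun lam hlam hsg => ⟨?_, ?_, ?_⟩⟩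
  · filter_upwards [hgrowth] with ω hω z
    obtain ⟨h1, h2⟩ := SlowFastSystem.flow_spec h hω z
    exact ⟨h1, h2, fun Z hZ hZ0 t ht => hZ.eq_of_eq h hω h1 (hZ0.trans h2.symm) ht⟩
  · obtain ⟨μ, hμ0, hμ, -⟩ := SlowFastSystem.exists_rate_of_gap hε hα hLf hLg hδ hgap
    exact ⟨μ, hμ0, hμ⟩
  · filter_upwards [hgrowth] with ω hω X0
    have h1 := SlowFastSystem.isPerronFixedPoint_perronOrbit h hω hlam hsg X0
    refine ⟨h1, fun u hu t ht => ?_⟩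
    exact (SlowFastSystem.isPerronFixedPoint_iff (h := h) (hω := hω).1 hu).unique
      (hsg.hasGap hlam) (SlowFastSystem.forcingIntegrable hlam)
      (SlowFastSystem.isPerronFixedPoint_iff.1 h1) ht
  · exact SlowFastSystem.isAsymptoticallyComplete_slowManifold h hgrowth hlam hsg hδ hgap hγ
  · refine ⟨1 + δ⁻¹, by positivity, ?_⟩
    filter_upwards [hgrowth] with ω hω Z hZ
    obtain ⟨Z', hZ', hmem, hdec⟩ :=
      SlowFastSystem.exists_tracking_slowManifold h hlam hsg hδ hgap hω hZ
    have hM : ∀ t : ℝ, 0 ≤ t → Z' t ∈ S.slowManifold lam (WienerPath.shift t ω) :=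
      fun t ht => hZ'.mem_slowManifold h hω hlam hsg hmem ht
    have hgraph := fun t ht => SlowFastSystem.eq_slowMap_of_mem_slowManifold (hM t ht)
    refine ⟨Z', hZ', hM, fun t ht => ?_, hgraph, hdec⟩
    have := (hZ' t ht).1
    rwa [hgraph t ht] at this
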